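/- For each $n\ge 1$ let $x_i=x_i^{[n]}=\mathcal G_i^{[n]}(\dots,e_{i-1}^{[n]},e_i^{[n]})$, $1\le i\le n$, be centered random vectors in $\mathbb R^{d}$, $d=d_n$, where $(e_i^{[n]})_{i\in\mathbb Z}$ are i.i.d. random elements and the $\mathcal G_i^{[n]}$ are measurable. For $q\ge1$, $k\ge 0$ and a coordinate $j$ put $$\theta_{k,j,q}:=\sup_n\max_{1\le i\le n}\big\|\mathcal G_{i,j}^{[n]}(\mathcal F_i^{[n]})-\mathcal G_{i,j}^{[n]}(\mathcal F_{i,i-k}^{[n]})\big\|_{q},$$ where $\mathcal F_i^{[n]}=(\dots,e^{[n]}_{i-1},e^{[n]}_i)$, $\mathcal F_{i,i-k}^{[n]}$ is obtained from it by replacing $e_{i-k}^{[n]}$ with $\hat e_{i-k}^{[n]}$, $(\hat e_i^{[n]})_{i\in\mathbb Z}$ is an independent copy of $(e_i^{[n]})_{i\in\mathbb Z}$, $\|Z\|_q=(\mathbb E|Z|^q)^{1/q}$, and the supremum runs over those $n$ with $d_n\ge j$. Let $X_n=\sum_{i=1}^n x_i$. Assume, for some $p\ge 4$: - the smallest eigenvalue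 of $\mathrm{Cov}(X_n/\sqrt n)$ is at least some constant $\lambda_*>0$ for all $n\ge1$; - $\sup_n\max_{1\le i\le n,\,1\le j\le d_n}\mathbb E|x_{i,j}^{[n]}|^p<\infty$; - $\theta_{m,j,p}=O\big((m+1)^{-(\chi+1)}(\log(m+1))^{-A}\big)$ as $m\to\infty$, uniformly in $j$, for some constants $\chi>1$ and $A>\sqrt{\chi+1}$. Let $L=L_n$ be integers with $1\le L_n\le n$, let $\psi_{i,L}=L^{-1/2}\sum_{l=i}^{i+L-1}x_l$, let $B_1,B_2,\dots$ be i.i.d. standard normal random variables (for each $n$) independent of $(x_1,\dots,x_n)$, and let $\tau_{n,L}=\sum_{i=1}^{n-L+1}B_i\psi_{i,L}$. Put $$D_n:=\mathrm{Cov}\Big[\frac{X_n}{\sqrt n}\Big]-\mathrm{Cov}\Big[\frac{\tau_{n,L}}{\sqrt{n-L+1}}\,\Big|\,x_1,\dots,x_n\Big],\qquad \Delta_n^{(1)}:=|D_n|_F,\qquad \Delta_n^{(2)}:=|D_n|_{\max},$$ where $|\cdot|_F$ is the Frobenius norm and $|\cdot|_{\max}$ is the entrywise maximum norm. Then, as $n\to\infty$,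 $$\Delta_n^{(1)}=O_{\mathbb P}\Big(d\Big(\sqrt{\tfrac Ln}+\tfrac1L\Big)\Big)\qquad\text{and}\qquad \Delta_n^{(2)}=O_{\mathbb P}\Big(\sqrt{\tfrac Ln}\,d^{4/p}+\tfrac Ln+\tfrac1L\Big).$$ -/

import Mathlib

open MeasureTheory ProbabilityTheory Filter

noncomputable section

/-- The shift `(e_i, e_{i-1}, e_{i-2}, …)` of the innovations up to time `i`;
entry `k` is `e_{i-k}`. -/
def past {Ω E : Type*} (e : ℤ → Ω → E) (i : ℤ) (ω : Ω) : ℕ → E :=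
  fun k => e (i - (k : ℤ)) ω

/-- The Bernoulli shift process `x_i = G_i(…, e_{i-1}, e_i)`. -/
def bernoulliShift {Ω E : Type*} {d : ℕ} (e : ℤ → Ω → E) (G : ℕ → (ℕ → E) → Fin d → ℝ)
    (i : ℕ) (ω : Ω) : Fin d → ℝ :=
  G i (past e (i : ℤ) ω)

/-- `G_i` applied to the past up to time `i` in which `e_{i-k}` is replaced by an independent copy.
The i.i.d. copy of `e` lives on the second factor of `Ω × Ω`
(equipped with the product measure): `ê_s (ω, ω') = e_s ω'`. -/
def coupledShift {Ω E : Type*} {d : ℕ} (e : ℤ → Ω → E) (G : ℕ → (ℕ → E) → Fin d → ℝ)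
    (i k : ℕ) (z : Ω × Ω) : Fin d → ℝ :=
  G i (Function.update (past e (i : ℤ) z.1) k (e ((i : ℤ) - (k : ℤ)) z.2))

/-- Physical dependence measure of a triangular array,
`θ_{k,j,q} = sup_n max_{1 ≤ i ≤ n} ‖G_{i,j}(F_i) - G_{i,j}(F_{i,i-k})‖_q`,
the supremum being over the rows `n` that have a coordinate `j` (coordinates are counted from `0`).
It is an extended nonnegative real. -/
def physDep {Ω E : ℕ → Type*} [∀ n, MeasurableSpace (Ω n)] (μ : ∀ n, Measure (Ω n))
    {d : ℕ → ℕ} (e : ∀ n, ℤ → Ω n → E n) (G : ∀ n, ℕ → (ℕ → E n) → Fin (d n) → ℝ)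
    (k j : ℕ) (q : ℝ) : ENNReal :=
  ⨆ (n : ℕ) (i ∈ Finset.Icc 1 n) (h : j < d n),
    eLpNorm (fun z : Ω n × Ω n =>
      bernoulliShift (e n) (G n) i z.1 ⟨j, h⟩ - coupledShift (e n) (G n) i k z ⟨j, h⟩)
      (ENNReal.ofReal q) ((μ n).prod (μ n))

/-- The data `(x_1, …, x_n)` as one random element. -/
def sample {Ω : Type*} {d : ℕ} (n : ℕ) (x : ℕ → Ω → Fin d → ℝ) (ω : Ω) :
    Finset.Icc 1 n → Fin d → ℝ :=
  fun i => x i ω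

/-- The sigma-algebra generated by the data `x_1, …, x_n`. -/
abbrev sampleSigma {Ω : Type*} {d : ℕ} (n : ℕ) (x : ℕ → Ω → Fin d → ℝ) : MeasurableSpace Ω :=
  MeasurableSpace.comap (sample n x) inferInstance

/-- The normalized sum `X_n / √n`, where `X_n = x_1 + ⋯ + x_n`. -/
def normSum {Ω : Type*} {d : ℕ} (n : ℕ) (x : ℕ → Ω → Fin d → ℝ) (ω : Ω) : Fin d → ℝ :=
  fun j => (∑ i ∈ Finset.Icc 1 n, x i ω j) / √(n : ℝ)

/-- The block sum `ψ_{i,L} = (x_i + ⋯ + x_{i+L-1}) / √L`. -/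
def blockSum {Ω : Type*} {d : ℕ} (L : ℕ) (x : ℕ → Ω → Fin d → ℝ) (i : ℕ) (ω : Ω) : Fin d → ℝ :=
  fun j => (∑ l ∈ Finset.Ico i (i + L), x l ω j) / √(L : ℝ)

/-- The multiplier bootstrap statistic `τ_{n,L} = ∑_{i=1}^{n-L+1} B_i ψ_{i,L}`
(used only for `L ≤ n`). -/
def bootStat {Ω : Type*} {d : ℕ} (n L : ℕ) (x : ℕ → Ω → Fin d → ℝ) (B : ℕ → Ω → ℝ) (ω : Ω) :
    Fin d → ℝ :=
  fun j => ∑ i ∈ Finset.Icc 1 (n - L + 1), B i ω * blockSum L x i ω j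

/-- The normalized bootstrap statistic `τ_{n,L} / √(n - L + 1)`. -/
def normBootStat {Ω : Type*} {d : ℕ} (n L : ℕ) (x : ℕ → Ω → Fin d → ℝ) (B : ℕ → Ω → ℝ) (ω : Ω) :
    Fin d → ℝ :=
  fun j => bootStat n L x B ω j / √((n : ℝ) - (L : ℝ) + 1)

/-- The covariance matrix of a random vector. -/
def covMat {Ω : Type*} [MeasurableSpace Ω] {d : ℕ} (μ : Measure Ω) (X : Ω → Fin d → ℝ) :
    Matrix (Fin d) (Fin d) ℝ :=
  Matrix.of fun j k => covariance (fun ω => X ω j) (fun ω => X ω k) μ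

/-- The conditional covariance matrix of a random vector given a sigma-algebra `m`:
entry `(j, k)` is `E[(X_j - E[X_j | m]) (X_k - E[X_k | m]) | m]`. -/
def condCovMat {Ω : Type*} [MeasurableSpace Ω] {d : ℕ} (μ : Measure Ω) (m : MeasurableSpace Ω)
    (X : Ω → Fin d → ℝ) (ω : Ω) : Matrix (Fin d) (Fin d) ℝ :=
  Matrix.of fun j k =>
    (μ[fun ω' => (X ω' j - (μ[fun ω'' => X ω'' j | m]) ω') *
      (X ω' k - (μ[fun ω'' => X ω'' k | m]) ω') | m]) ω

/-- The Frobenius norm. -/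
def frobNorm {d : ℕ} (A : Matrix (Fin d) (Fin d) ℝ) : ℝ :=
  √(∑ j, ∑ k, A j k ^ 2)

/-- The entrywise maximum norm (`0` for the empty matrix). -/
def maxNorm {d : ℕ} (A : Matrix (Fin d) (Fin d) ℝ) : ℝ :=
  ⨆ jk : Fin d × Fin d, |A jk.1 jk.2|

/-- The random matrix
`Cov[X_n / √n] - Cov[τ_{n,L} / √(n - L + 1) | x_1, …, x_n]`. -/
def covError {Ω : Type*} [MeasurableSpace Ω] {d : ℕ} (n L : ℕ) (μ : Measure Ω)
    (x : ℕ → Ω → Fin d → ℝ) (B : ℕ → Ω → ℝ) (ω : Ω) : Matrix (Fin d) (Fin d) ℝ :=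
  covMat μ (normSum n x) - condCovMat μ (sampleSigma n x) (normBootStat n L x B) ω

/-- `Z_n = O_P(a_n)`: for every `ε > 0` there is `M > 0` such that
`P(|Z_n| > M a_n) ≤ ε` for all large `n`. The `n`-th variable may live on its own space. -/
def BoundedInProb {Ω : ℕ → Type*} [∀ n, MeasurableSpace (Ω n)] (μ : ∀ n, Measure (Ω n))
    (Z : ∀ n, Ω n → ℝ) (a : ℕ → ℝ) : Prop :=
  ∀ ε : ℝ, 0 < ε → ∃ M : ℝ, 0 < M ∧
    ∀ᶠ n in atTop, μ n {ω | M * a n < |Z n ω|} ≤ ENNReal.ofReal ε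

end

/-!
# Covariance error of the multiplier bootstrap for weakly dependent vectors

Given the data, the covariance of the bootstrap statistic is the average of the products
`ψ_{i,L} ψ_{i,L}ᵀ` of block sums (`condCovMat_normBootStat`), so each entry of the error matrix
splits into a deterministic bias and a centered fluctuation (`exists_bias_add_fluctuation`).

Both parts are controlled through the influences of single innovations. Let `f` be a function of an
independent sequence, and let `δ_k(f)` be the `L^q` distance between `f` and its value after the
entry `k` has been resampled. Revealing the entries one by one gives a martingale with increments
bounded by `δ_k(f)`: conditioning on the first `k` entries means integrating the others over an
independent copy, and two consecutive hybrid sequences have the joint law of the sequence and its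
resampled version (`map_mix_succ_mix`). For `q ≥ 2` a martingale increment adds at most a constant
times its squared norm to the squared `L^q` norm (`eLpNorm_add_sq_le`), whence
`‖f - E f‖_q² ≤ C_q ∑ δ_k(f)²` (`eLpNorm_sub_integral_sq_le`), and orthogonality of the increments
gives `|Cov(f, g)| ≤ ∑ δ_k(f) δ_k(g)` (`enorm_covariance_le`). Since the innovations up to time `n`
are listed backwards from `n`, no infinite past has to be removed.

For the fluctuation, the first inequality is applied with `q = p / 2` to the whole sum of the
products of block sums. By the Leibniz rule `influence_mul_le` and the bound of order `√L` for the
norm of a block sum, the influence of one innovation is of order `√L min(L, N) ∑_a θ_{a - t}`, where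
`N = n - L + 1` is the number of blocks and `t` the time of the innovation; summing squares over `t`
gives the order `√(L / n)` after normalization.

For the bias, the covariance of a block with itself is its covariance with the full sum, up to
covariances of the block with the variables before and after it. The latter are bounded uniformly
because `∑ m θ_m` is finite (`tsum_lagSum_mul_le_of_separated`) and contribute `1 / L`; the former
reproduce the covariance of the full sum up to the uneven number of blocks covering each time, which
costs `L / n` (`sum_abs_weight_le`).

The Frobenius norm is then handled by Chebyshev's inequality, and the maximum norm by a union bound
over the `d²` entries with moments of order `p / 2`, which is the source of the factor `d ^ (4 / p)`.
-/

open scoped ENNReal NNReal Topology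

/-! ### Second-order expansion of absolute powers -/

/-- The signed power `|u| ^ (q - 2) * u`, which is `1 / q` times the derivative of `|u| ^ q`. -/
noncomputable def signedPow (q u : ℝ) : ℝ := |u| ^ (q - 2) * u

lemma rpow_sub_two_mul_sq {q : ℝ} (hq : 2 ≤ q) {u : ℝ} (hu : 0 ≤ u) :
    u ^ (q - 2) * u ^ 2 = u ^ q := by
  rcases hu.eq_or_lt with rfl | hu
  · rw [Real.zero_rpow (by linarith : q ≠ 0)]; simp
  · rw [← Real.rpow_natCast u 2, ← Real.rpow_add hu]; norm_num

lemma rpow_sub_two_mul_self {q : ℝ} (hq : 2 ≤ q) {u : ℝ} (hu : 0 ≤ u) :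
    u ^ (q - 2) * u = u ^ (q - 1) := by
  rcases hu.eq_or_lt with rfl | hu
  · rw [Real.zero_rpow (by linarith : q - 1 ≠ 0)]; simp
  · nth_rewrite 2 [← Real.rpow_one u]
    rw [← Real.rpow_add hu]; congr 1; ring

lemma abs_signedPow {q : ℝ} (hq : 2 ≤ q) (u : ℝ) : |signedPow q u| = |u| ^ (q - 1) := by
  rw [signedPow, abs_mul, abs_of_nonneg (Real.rpow_nonneg (abs_nonneg u) _),
    rpow_sub_two_mul_self hq (abs_nonneg u)]

lemma signedPow_mul_self {q : ℝ} (hq : 2 ≤ q) (u : ℝ) : signedPow q u * u = |u| ^ q := by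
  rw [signedPow, mul_assoc, ← sq, ← sq_abs, rpow_sub_two_mul_sq hq (abs_nonneg u)]

/-- Convexity of `u ^ q` on the half line, in the form of Young's inequality. -/
lemma rpow_add_mul_rpow_sub_one_le {q u v : ℝ} (hq : 1 ≤ q) (hu : 0 ≤ u) (hv : 0 ≤ v) :
    q * (u ^ (q - 1) * v) ≤ (q - 1) * u ^ q + v ^ q := by
  have h0 : q ≠ 0 := by linarith
  have hw := Real.geom_mean_le_arith_mean2_weighted (w₁ := (q - 1) / q) (w₂ := 1 / q)
    (p₁ := u ^ q) (p₂ := v ^ q) (by apply div_nonneg <;> linarith) (by positivity) (by positivity)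
    (by positivity) (by field_simp; ring)
  rw [← Real.rpow_mul hu, ← Real.rpow_mul hv, mul_div_cancel₀ _ h0, mul_one_div_cancel h0,
    Real.rpow_one] at hw
  calc q * (u ^ (q - 1) * v) ≤ q * ((q - 1) / q * u ^ q + 1 / q * v ^ q) := by gcongr
    _ = _ := by field_simp

/-- The gradient inequality for the convex function `|u| ^ q`. -/
lemma abs_rpow_gradient_le {q : ℝ} (hq : 2 ≤ q) (u v : ℝ) :
    |u| ^ q + q * (signedPow q u * (v - u)) ≤ |v| ^ q := by
  have h1 := rpow_add_mul_rpow_sub_one_le (q := q) (by linarith) (abs_nonneg u) (abs_nonneg v)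
  have h2 : signedPow q u * v ≤ |u| ^ (q - 1) * |v| := by
    rw [← abs_signedPow hq, ← abs_mul]; exact le_abs_self _
  have h3 := signedPow_mul_self hq u
  have : q * (signedPow q u * v) ≤ q * (|u| ^ (q - 1) * |v|) := by gcongr
  rw [mul_sub, mul_sub, h3]; linarith

lemma abs_signedPow_sub_le {q : ℝ} (hq : 2 ≤ q) (u v : ℝ) :
    |signedPow q u - signedPow q v| ≤ (q - 1) * (max |u| |v| ^ (q - 2) * |u - v|) := by
  -- for `u ≥ v ≥ 0` this is the gradient inequality for the power `q - 1`
  have key : ∀ a b : ℝ, 0 ≤ b → b ≤ a →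
      |signedPow q a - signedPow q b| ≤ (q - 1) * (max |a| |b| ^ (q - 2) * |a - b|) := by
    intro a b hb hab
    have ha := hb.trans hab
    have h := rpow_add_mul_rpow_sub_one_le (q := q - 1) (by linarith) ha hb
    have hm : b ^ (q - 1) ≤ a ^ (q - 1) := Real.rpow_le_rpow hb hab (by linarith)
    have e1 : a ^ (q - 1) = a ^ (q - 2) * a := (rpow_sub_two_mul_self hq ha).symm
    have e2 : q - 1 - 1 = q - 2 := by ring
    rw [e2] at h
    simp only [signedPow, abs_of_nonneg ha, abs_of_nonneg hb, rpow_sub_two_mul_self hq ha,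
      rpow_sub_two_mul_self hq hb, max_eq_left hab, abs_of_nonneg (sub_nonneg.2 hab),
      abs_of_nonneg (sub_nonneg.2 hm)]
    rw [e1] at h ⊢
    linarith
  have opp : ∀ a b : ℝ, 0 ≤ a → b ≤ 0 →
      |signedPow q a - signedPow q b| ≤ (q - 1) * (max |a| |b| ^ (q - 2) * |a - b|) := by
    intro a b ha hb
    have hm : 0 ≤ max |a| |b| ^ (q - 2) := by positivity
    have h1 : |a| ^ (q - 2) ≤ max |a| |b| ^ (q - 2) :=
      Real.rpow_le_rpow (abs_nonneg _) (le_max_left _ _) (by linarith)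
    have h2 : |b| ^ (q - 2) ≤ max |a| |b| ^ (q - 2) :=
      Real.rpow_le_rpow (abs_nonneg _) (le_max_right _ _) (by linarith)
    calc |signedPow q a - signedPow q b| ≤ |signedPow q a| + |signedPow q b| := abs_sub _ _
      _ = |a| ^ (q - 2) * a + |b| ^ (q - 2) * (-b) := by
        simp only [signedPow, abs_mul, abs_of_nonneg (Real.rpow_nonneg (abs_nonneg _) _)]
        rw [abs_of_nonneg ha, abs_of_nonpos hb]
      _ ≤ max |a| |b| ^ (q - 2) * a + max |a| |b| ^ (q - 2) * (-b) := by gcongr; linarith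
      _ = max |a| |b| ^ (q - 2) * |a - b| := by
        rw [abs_of_nonneg (by linarith : 0 ≤ a - b)]; ring
      _ ≤ _ := le_mul_of_one_le_left (by positivity) (by linarith)
  have neg : ∀ a, signedPow q (-a) = - signedPow q a := fun a => by simp [signedPow]
  wlog huv : v ≤ u generalizing u v
  · have := this v u (by linarith)
    rwa [abs_sub_comm, max_comm, abs_sub_comm u v]
  rcases le_total 0 v with hv | hv
  · exact key u v hv huv
  rcases le_total 0 u with hu | hu
  · exact opp u v hu hv
  · have := key (-v) (-u) (by linarith) (by linarith)
    rw [neg, neg, abs_neg, abs_neg, max_comm] at this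
    convert this using 2
    · ring
    · congr 2; ring

/-- The constant in the second-order expansion of `|x + y| ^ q`. -/
noncomputable def expansionConst (q : ℝ) : ℝ := q * (q - 1) * 2 ^ (q - 2)

lemma one_le_expansionConst {q : ℝ} (hq : 2 ≤ q) : 1 ≤ expansionConst q := by
  have : (1 : ℝ) ≤ 2 ^ (q - 2) := Real.one_le_rpow (by norm_num) (by linarith)
  exact one_le_mul_of_one_le_of_one_le (by nlinarith) this

/-- Second-order expansion of `|x + y| ^ q` around `x`. -/
lemma abs_add_rpow_le {q : ℝ} (hq : 2 ≤ q) (x y : ℝ) :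
    |x + y| ^ q ≤ |x| ^ q + q * (signedPow q x * y) +
      expansionConst q * (|x| ^ (q - 2) * |y| ^ 2 + |y| ^ q) := by
  have h1 := abs_rpow_gradient_le hq (x + y) x
  have h2 := abs_signedPow_sub_le hq (x + y) x
  have hmax : max |x + y| |x| ^ (q - 2) ≤ 2 ^ (q - 2) * (|x| ^ (q - 2) + |y| ^ (q - 2)) := by
    have h3 : max |x + y| |x| ≤ 2 * max |x| |y| := by
      refine max_le ((abs_add_le x y).trans ?_) ?_
      · linarith [le_max_left |x| |y|, le_max_right |x| |y|]
      · linarith [le_max_left |x| |y|, abs_nonneg x]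
    calc max |x + y| |x| ^ (q - 2) ≤ (2 * max |x| |y|) ^ (q - 2) :=
          Real.rpow_le_rpow (by positivity) h3 (by linarith)
      _ = 2 ^ (q - 2) * max |x| |y| ^ (q - 2) := Real.mul_rpow (by norm_num) (by positivity)
      _ ≤ _ := by
        gcongr
        rcases max_choice |x| |y| with h | h <;> rw [h]
        · exact le_add_of_nonneg_right (by positivity)
        · exact le_add_of_nonneg_left (by positivity)
  rw [add_sub_cancel_left] at h2
  have h4 : (signedPow q (x + y) - signedPow q x) * y ≤
      (q - 1) * (2 ^ (q - 2) * (|x| ^ (q - 2) + |y| ^ (q - 2)) * |y|) * |y| := by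
    calc _ ≤ |(signedPow q (x + y) - signedPow q x) * y| := le_abs_self _
      _ = |signedPow q (x + y) - signedPow q x| * |y| := abs_mul _ _
      _ ≤ _ := by
        gcongr
        refine h2.trans ?_
        gcongr
        linarith
  have h5 := rpow_sub_two_mul_sq hq (abs_nonneg y)
  have h6 : q * ((signedPow q (x + y) - signedPow q x) * y) ≤
      expansionConst q * (|x| ^ (q - 2) * |y| ^ 2 + |y| ^ q) := by
    calc _ ≤ q * ((q - 1) * (2 ^ (q - 2) * (|x| ^ (q - 2) + |y| ^ (q - 2)) * |y|) * |y|) := by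
          gcongr
      _ = _ := by rw [← h5, expansionConst]; ring
  have h7 : x - (x + y) = -y := by ring
  rw [h7] at h1
  nlinarith

/-- Passage from the additive bound on `q`-th powers, with `r = q / 2`, to a bound on squared norms:
the right-hand side dominates the mean of its convexity and superadditivity lower bounds. -/
lemma rpow_add_expansion_le {r c A B : ℝ} (hr : 1 ≤ r) (hc : 1 ≤ c) (hA : 0 ≤ A) (hB : 0 ≤ B) :
    A ^ r + c * (A ^ (r - 1) * B + B ^ r) ≤ (A + 2 * c * B) ^ r := by
  have hD : 0 ≤ 2 * c * B := by positivity
  have h1 := rpow_add_mul_rpow_sub_one_le hr hA (add_nonneg hA hD)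
  have h2 : A ^ r + (2 * c * B) ^ r ≤ (A + 2 * c * B) ^ r := by
    have := NNReal.add_rpow_le_rpow_add ⟨A, hA⟩ ⟨2 * c * B, hD⟩ hr
    exact_mod_cast this
  have h3 : 2 * c * B ^ r ≤ (2 * c * B) ^ r := by
    rw [Real.mul_rpow (by positivity) hB]
    gcongr
    exact Real.self_le_rpow_of_one_le (by linarith) hr
  have h4 : A ^ (r - 1) * A = A ^ r := by
    rcases hA.eq_or_lt with rfl | hA
    · rw [Real.zero_rpow (by linarith : r ≠ 0)]; simp
    · nth_rewrite 2 [← Real.rpow_one A]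
      rw [← Real.rpow_add hA]; congr 1; ring
  have h5 : 0 ≤ A ^ (r - 1) * B := by positivity
  have h6 : 2 * c * (A ^ (r - 1) * B) ≤ r * (2 * c * (A ^ (r - 1) * B)) :=
    le_mul_of_one_le_left (by positivity) hr
  have h7 : r * (A ^ (r - 1) * (A + 2 * c * B)) =
    r * A ^ r + r * (2 * c * (A ^ (r - 1) * B)) := by rw [← h4]; ring
  nlinarith

/-! ### Martingale increments in `L^q` -/

section

/-- The constant of the moment inequality for a sum with a martingale increment. -/
noncomputable def martConst (q : ℝ) : ℝ≥0 := Real.toNNReal (2 * expansionConst q)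

variable {Ω : Type*} {m₀ : MeasurableSpace Ω} {μ : Measure Ω}

lemma lintegral_enorm_rpow_eq_eLpNorm_rpow {q : ℝ} (hq : 0 < q) (X : Ω → ℝ) :
    ∫⁻ ω, ‖X ω‖ₑ ^ q ∂μ = eLpNorm X (ENNReal.ofReal q) μ ^ q := by
  rw [eLpNorm_eq_lintegral_rpow_enorm_toReal (by simpa using hq) (by simp),
    ENNReal.toReal_ofReal hq.le, ← ENNReal.rpow_mul, one_div_mul_cancel hq.ne', ENNReal.rpow_one]

lemma integral_abs_rpow_eq_toReal {q : ℝ} (hq : 0 < q) {X : Ω → ℝ}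
    (hX : AEStronglyMeasurable X μ) :
    ∫ ω, |X ω| ^ q ∂μ = (eLpNorm X (ENNReal.ofReal q) μ).toReal ^ q := by
  simp_rw [← Real.norm_eq_abs]
  rw [integral_eq_lintegral_of_nonneg_ae (ae_of_all _ fun ω => by positivity)
    ((hX.norm.aemeasurable.pow_const q).aestronglyMeasurable), ENNReal.toReal_rpow,
    ← lintegral_enorm_rpow_eq_eLpNorm_rpow hq]
  congr 1
  refine lintegral_congr fun ω => ?_
  rw [← ENNReal.ofReal_rpow_of_nonneg (norm_nonneg _) hq.le, ofReal_norm]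

lemma integrable_abs_rpow {q : ℝ} (hq : 0 < q) {X : Ω → ℝ}
    (hX : MemLp X (ENNReal.ofReal q) μ) : Integrable (fun ω => |X ω| ^ q) μ := by
  have := hX.integrable_norm_rpow (by simpa using hq) (by simp)
  simpa [ENNReal.toReal_ofReal hq.le] using this

lemma rpow_sub_two_mul_sq_le {q a b : ℝ} (hq : 2 ≤ q) (ha : 0 ≤ a) (hb : 0 ≤ b) :
    a ^ (q - 2) * b ^ 2 ≤ a ^ q + b ^ q := by
  have h1 : a ^ (q - 2) ≤ max a b ^ (q - 2) :=
    Real.rpow_le_rpow ha (le_max_left _ _) (by linarith)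
  have h2 : b ^ 2 ≤ max a b ^ 2 := pow_le_pow_left₀ hb (le_max_right _ _) 2
  calc _ ≤ max a b ^ (q - 2) * max a b ^ 2 := by gcongr
    _ = max a b ^ q := rpow_sub_two_mul_sq hq (ha.trans (le_max_left _ _))
    _ ≤ _ := by
      rcases max_choice a b with h | h <;> rw [h]
      · exact le_add_of_nonneg_right (by positivity)
      · exact le_add_of_nonneg_left (by positivity)

lemma rpow_sub_one_mul_le {q a b : ℝ} (hq : 2 ≤ q) (ha : 0 ≤ a) (hb : 0 ≤ b) :
    a ^ (q - 1) * b ≤ a ^ q + b ^ q := by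
  have h := rpow_add_mul_rpow_sub_one_le (q := q) (by linarith) ha hb
  have h1 : 0 ≤ a ^ q := by positivity
  have h2 : 0 ≤ b ^ q := by positivity
  have h3 : 0 ≤ a ^ (q - 1) * b := by positivity
  nlinarith

/-- Hölder's inequality with the weights `(q - 2) / q` and `2 / q`, in a form that covers `q = 2`. -/
lemma integral_rpow_sub_two_mul_sq_le {q : ℝ} (hq : 2 ≤ q) {X Y : Ω → ℝ}
    (hX : MemLp X (ENNReal.ofReal q) μ) (hY : MemLp Y (ENNReal.ofReal q) μ) :
    Integrable (fun ω => |X ω| ^ (q - 2) * |Y ω| ^ 2) μ ∧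
    ∫ ω, |X ω| ^ (q - 2) * |Y ω| ^ 2 ∂μ ≤
      (eLpNorm X (ENNReal.ofReal q) μ).toReal ^ (q - 2) *
        (eLpNorm Y (ENNReal.ofReal q) μ).toReal ^ 2 := by
  have hq0 : 0 < q := by linarith
  have hm : AEStronglyMeasurable (fun ω => |X ω| ^ (q - 2) * |Y ω| ^ 2) μ :=
    ((hX.1.norm.aemeasurable.pow_const _).mul
      (hY.1.norm.aemeasurable.pow_const _)).aestronglyMeasurable
  have hint : Integrable (fun ω => |X ω| ^ (q - 2) * |Y ω| ^ 2) μ := by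
    refine ((integrable_abs_rpow hq0 hX).add (integrable_abs_rpow hq0 hY)).mono' hm
      (ae_of_all _ fun ω => ?_)
    rw [Real.norm_of_nonneg (by positivity)]
    exact rpow_sub_two_mul_sq_le hq (abs_nonneg _) (abs_nonneg _)
  refine ⟨hint, ?_⟩
  have h := ENNReal.lintegral_mul_norm_pow_le (μ := μ) (f := fun ω => ‖X ω‖ₑ ^ q)
    (g := fun ω => ‖Y ω‖ₑ ^ q) (hX.1.enorm.pow_const _) (hY.1.enorm.pow_const _)
    (p := (q - 2) / q) (q := 2 / q) (by apply div_nonneg <;> linarith) (by positivity)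
    (by field_simp; ring)
  simp only [lintegral_enorm_rpow_eq_eLpNorm_rpow hq0, ← ENNReal.rpow_mul,
    mul_div_cancel₀ _ hq0.ne'] at h
  rw [integral_eq_lintegral_of_nonneg_ae (ae_of_all _ fun ω => by positivity) hm,
    ENNReal.toReal_rpow, ← ENNReal.toReal_pow, ← ENNReal.toReal_mul]
  refine ENNReal.toReal_mono ?_ (le_trans (le_of_eq ?_) (h.trans (le_of_eq ?_)))
  · exact ENNReal.mul_ne_top (ENNReal.rpow_ne_top_of_nonneg (by linarith) hX.2.ne)
      (ENNReal.pow_ne_top hY.2.ne)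
  · refine lintegral_congr fun ω => ?_
    rw [ENNReal.ofReal_mul (by positivity),
      ← ENNReal.ofReal_rpow_of_nonneg (abs_nonneg _) (by linarith),
      ENNReal.ofReal_pow (abs_nonneg _), ← Real.norm_eq_abs, ← Real.norm_eq_abs,
      ofReal_norm, ofReal_norm, ← ENNReal.rpow_natCast _ 2]
    norm_num
  · rw [← ENNReal.rpow_natCast _ 2]
    norm_num

/-- A martingale increment `Y` with respect to `m` is orthogonal to the signed powers of any
`m`-measurable random variable. -/
lemma integral_signedPow_mul_eq_zero [IsProbabilityMeasure μ] {q : ℝ} (hq : 2 ≤ q)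
    {m : MeasurableSpace Ω} (hm : m ≤ m₀) {X Y : Ω → ℝ}
    (hX : MemLp X (ENNReal.ofReal q) μ) (hXm : StronglyMeasurable[m] X)
    (hY : MemLp Y (ENNReal.ofReal q) μ) (hY0 : μ[Y | m] =ᵐ[μ] 0) :
    Integrable (fun ω => signedPow q (X ω) * Y ω) μ ∧ ∫ ω, signedPow q (X ω) * Y ω ∂μ = 0 := by
  have hq0 : 0 < q := by linarith
  have hφ : Measurable (signedPow q) := by unfold signedPow; fun_prop
  have hφX : StronglyMeasurable[m] (fun ω => signedPow q (X ω)) :=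
    (hφ.comp hXm.measurable).stronglyMeasurable
  have hint : Integrable (fun ω => signedPow q (X ω) * Y ω) μ := by
    refine ((integrable_abs_rpow hq0 hX).add (integrable_abs_rpow hq0 hY)).mono'
      ((hφX.mono hm).aestronglyMeasurable.mul hY.1) (ae_of_all _ fun ω => ?_)
    rw [Real.norm_eq_abs, abs_mul, abs_signedPow hq]
    exact rpow_sub_one_mul_le hq (abs_nonneg _) (abs_nonneg _)
  refine ⟨hint, ?_⟩
  have hYi : Integrable Y μ := hY.integrable (by simpa using by linarith)
  have h := condExp_mul_of_stronglyMeasurable_left (g := Y) hφX hint hYi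
  calc ∫ ω, signedPow q (X ω) * Y ω ∂μ
      = ∫ ω, (μ[(fun ω => signedPow q (X ω)) * Y | m]) ω ∂μ := (integral_condExp hm).symm
    _ = ∫ ω, (0 : ℝ) ∂μ := by
      refine integral_congr_ae ?_
      filter_upwards [h, hY0] with ω h1 h2
      rw [h1, Pi.mul_apply, h2]; simp
    _ = 0 := by simp

/-- Adding a martingale increment `Y` to an `m`-measurable `X` increases the squared `L^q` norm by
at most a constant times the squared `L^q` norm of `Y`. -/
theorem eLpNorm_add_sq_le [IsProbabilityMeasure μ] {q : ℝ} (hq : 2 ≤ q)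
    {m : MeasurableSpace Ω} (hm : m ≤ m₀) {X Y : Ω → ℝ}
    (hX : MemLp X (ENNReal.ofReal q) μ) (hXm : StronglyMeasurable[m] X)
    (hY : MemLp Y (ENNReal.ofReal q) μ) (hY0 : μ[Y | m] =ᵐ[μ] 0) :
    eLpNorm (X + Y) (ENNReal.ofReal q) μ ^ 2 ≤
      eLpNorm X (ENNReal.ofReal q) μ ^ 2 + martConst q * eLpNorm Y (ENNReal.ofReal q) μ ^ 2 := by
  have hq0 : 0 < q := by linarith
  have hc := one_le_expansionConst hq
  obtain ⟨i1, e1⟩ := integral_signedPow_mul_eq_zero hq hm hX hXm hY hY0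
  obtain ⟨i2, e2⟩ := integral_rpow_sub_two_mul_sq_le hq hX hY
  have iX := integrable_abs_rpow hq0 hX
  have iY := integrable_abs_rpow hq0 hY
  have i3 : Integrable (fun ω => q * (signedPow q (X ω) * Y ω)) μ := i1.const_mul _
  have i4 : Integrable (fun ω => |X ω| ^ q + q * (signedPow q (X ω) * Y ω)) μ := iX.add i3
  have i5 : Integrable (fun ω => expansionConst q *
    (|X ω| ^ (q - 2) * |Y ω| ^ 2 + |Y ω| ^ q)) μ := (i2.add iY).const_mul _
  set a := (eLpNorm X (ENNReal.ofReal q) μ).toReal with ha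
  set b := (eLpNorm Y (ENNReal.ofReal q) μ).toReal with hb
  set s := (eLpNorm (X + Y) (ENNReal.ofReal q) μ).toReal with hs
  have ha0 : 0 ≤ a := ENNReal.toReal_nonneg
  have hb0 : 0 ≤ b := ENNReal.toReal_nonneg
  have hs0 : 0 ≤ s := ENNReal.toReal_nonneg
  have hmain : s ^ q ≤ a ^ q + expansionConst q * (a ^ (q - 2) * b ^ 2 + b ^ q) := by
    rw [hs, ← integral_abs_rpow_eq_toReal hq0 (hX.add hY).1]
    calc ∫ ω, |(X + Y) ω| ^ q ∂μ ≤ ∫ ω, (|X ω| ^ q + q * (signedPow q (X ω) * Y ω) +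
          expansionConst q * (|X ω| ^ (q - 2) * |Y ω| ^ 2 + |Y ω| ^ q)) ∂μ :=
        integral_mono (integrable_abs_rpow hq0 (hX.add hY))
          (i4.add i5)
          fun ω => abs_add_rpow_le hq (X ω) (Y ω)
      _ = ∫ ω, |X ω| ^ q ∂μ + q * ∫ ω, signedPow q (X ω) * Y ω ∂μ + expansionConst q *
          (∫ ω, |X ω| ^ (q - 2) * |Y ω| ^ 2 ∂μ + ∫ ω, |Y ω| ^ q ∂μ) := by
        rw [integral_add i4 i5, integral_add iX i3, integral_const_mul, integral_const_mul,
          integral_add i2 iY]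
      _ ≤ _ := by
        rw [e1, mul_zero, add_zero, integral_abs_rpow_eq_toReal hq0 hX.1,
          integral_abs_rpow_eq_toReal hq0 hY.1]
        gcongr
  have hpow : ∀ t : ℝ, 0 ≤ t → (t ^ 2) ^ (q / 2) = t ^ q := fun t ht => by
    rw [← Real.rpow_natCast t 2, ← Real.rpow_mul ht]; congr 1; push_cast; ring
  have hpow' : (a ^ 2) ^ (q / 2 - 1) = a ^ (q - 2) := by
    rw [← Real.rpow_natCast a 2, ← Real.rpow_mul ha0]; congr 1; push_cast; ring
  have hexp := rpow_add_expansion_le (r := q / 2) (by linarith) hc (sq_nonneg a) (sq_nonneg b)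
  rw [hpow a ha0, hpow b hb0, hpow'] at hexp
  have hfin : s ^ 2 ≤ a ^ 2 + 2 * expansionConst q * b ^ 2 := by
    refine (Real.rpow_le_rpow_iff (sq_nonneg s) (by positivity) (z := q / 2) (by linarith)).1 ?_
    rw [hpow s hs0]
    exact hmain.trans hexp
  rw [← ENNReal.ofReal_toReal (hX.add hY).2.ne, ← ENNReal.ofReal_toReal hX.2.ne,
    ← ENNReal.ofReal_toReal hY.2.ne, ← ENNReal.ofReal_pow hs0, ← ENNReal.ofReal_pow ha0,
    ← ENNReal.ofReal_pow hb0, martConst, ENNReal.ofNNReal_toNNReal,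
    ← ENNReal.ofReal_mul (by positivity), ← ENNReal.ofReal_add (by positivity) (by positivity)]
  exact ENNReal.ofReal_le_ofReal hfin

end

/-! ### Hybrid and resampled innovations -/

section

variable {Ω E : Type*}

/-- The whole sequence of innovations as one random element. -/
def innov (ε : ℕ → Ω → E) (ω : Ω) : ℕ → E := fun j => ε j ω

/-- The hybrid sequence: the first `k` innovations come from the first factor of `Ω × Ω`, the
others from the second factor. -/
def mix (ε : ℕ → Ω → E) (k : ℕ) (z : Ω × Ω) : ℕ → E :=
  fun j => if j < k then ε j z.1 else ε j z.2

/-- The sequence of innovations in which the entry `k` is replaced by an independent copy. -/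
def resample (ε : ℕ → Ω → E) (k : ℕ) (z : Ω × Ω) : ℕ → E :=
  Function.update (innov ε z.1) k (ε k z.2)

variable [m₀ : MeasurableSpace Ω] [MeasurableSpace E] {μ : Measure Ω} [IsProbabilityMeasure μ]
  {ε : ℕ → Ω → E}

lemma measurable_innov (hε : ∀ k, Measurable (ε k)) : Measurable (innov ε) :=
  measurable_pi_lambda _ hε

lemma measurable_mix (hε : ∀ k, Measurable (ε k)) (k : ℕ) : Measurable (mix ε k) := by
  refine measurable_pi_lambda _ fun j => ?_
  by_cases h : j < k
  · have e : (fun z : Ω × Ω => mix ε k z j) = ε j ∘ Prod.fst := by funext z; simp [mix, h]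
    exact e ▸ (hε j).comp measurable_fst
  · have e : (fun z : Ω × Ω => mix ε k z j) = ε j ∘ Prod.snd := by funext z; simp [mix, h]
    exact e ▸ (hε j).comp measurable_snd

lemma measurable_update_pair (k : ℕ) :
    Measurable fun y : (ℕ → E) × E => Function.update y.1 k y.2 := by
  refine measurable_pi_lambda _ fun j => ?_
  by_cases h : j = k
  · subst h
    simpa using measurable_snd
  · simp only [Function.update_of_ne h]
    exact (measurable_pi_apply j).comp measurable_fst

lemma measurable_resample (hε : ∀ k, Measurable (ε k)) (k : ℕ) : Measurable (resample ε k) :=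
  (measurable_update_pair k).comp
    (((measurable_innov hε).comp measurable_fst).prodMk ((hε k).comp measurable_snd))

lemma measurePreserving_cond (b : Bool) :
    MeasurePreserving (fun z : Ω × Ω => cond b z.1 z.2) (μ.prod μ) μ := by
  cases b
  · exact measurePreserving_snd
  · exact measurePreserving_fst

/-- The innovations on the two factors of `Ω × Ω` form one independent family. -/
lemma iIndepFun_two_copies (hε : ∀ k, Measurable (ε k)) (hind : iIndepFun ε μ) :
    iIndepFun (fun (p : Bool × ℕ) (z : Ω × Ω) => ε p.2 (cond p.1 z.1 z.2)) (μ.prod μ) := by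
  have hcond := measurePreserving_cond (μ := μ)
  have hmeas : ∀ (b : Bool) (j : ℕ), Measurable fun z : Ω × Ω => ε j (cond b z.1 z.2) :=
    fun b j => (hε j).comp (hcond b).measurable
  have hmeas' : ∀ b : Bool, Measurable fun (z : Ω × Ω) (j : ℕ) => ε j (cond b z.1 z.2) :=
    fun b => measurable_pi_lambda _ (hmeas b)
  refine iIndepFun_uncurry' (X := fun (b : Bool) (j : ℕ) (z : Ω × Ω) => ε j (cond b z.1 z.2))
    hmeas ?_ fun b => ?_
  · rw [iIndepFun_iff_map_fun_eq_pi_map fun b => (hmeas' b).aemeasurable]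
    symm
    have hlaw : ∀ b : Bool, (μ.prod μ).map (fun (z : Ω × Ω) (j : ℕ) => ε j (cond b z.1 z.2)) =
        μ.map (innov ε) := fun b => by
      rw [← (hcond b).map_eq, Measure.map_map (measurable_innov hε) (hcond b).measurable,
        (hcond b).map_eq]
      rfl
    have : IsProbabilityMeasure (μ.map (innov ε)) :=
      Measure.isProbabilityMeasure_map (measurable_innov hε).aemeasurable
    simp only [hlaw]
    refine Measure.pi_eq fun s hs => ?_
    rw [Measure.map_apply (measurable_pi_lambda _ hmeas') (MeasurableSet.univ_pi hs)]
    have : (fun (z : Ω × Ω) (b : Bool) (j : ℕ) => ε j (cond b z.1 z.2)) ⁻¹' (Set.univ.pi s) =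
        (innov ε ⁻¹' s true) ×ˢ (innov ε ⁻¹' s false) := by
      ext z
      simp only [Set.mem_preimage, Set.mem_pi, Set.mem_univ, true_imp_iff, Bool.forall_bool,
        Set.mem_prod, cond_true, cond_false]
      exact and_comm
    rw [this, Measure.prod_prod, Fintype.prod_bool,
      Measure.map_apply (measurable_innov hε) (hs _), Measure.map_apply (measurable_innov hε) (hs _)]
  · have h := (iIndepFun_iff_map_fun_eq_infinitePi_map hε).1 hind
    rw [iIndepFun_iff_map_fun_eq_infinitePi_map (hmeas b)]
    have e1 : (fun (z : Ω × Ω) (j : ℕ) => ε j (cond b z.1 z.2)) =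
      innov ε ∘ (fun z : Ω × Ω => cond b z.1 z.2) := rfl
    have e2 : ∀ j, (fun (z : Ω × Ω) => ε j (cond b z.1 z.2)) =
      ε j ∘ (fun z : Ω × Ω => cond b z.1 z.2) := fun j => rfl
    simp only [e2]
    rw [e1, ← Measure.map_map (measurable_innov hε) (hcond b).measurable, (hcond b).map_eq]
    refine h.trans ?_
    congr 1
    funext j
    rw [← Measure.map_map (hε j) (hcond b).measurable, (hcond b).map_eq]

/-- Any two ways of choosing, without repetition, the factor of `Ω × Ω` from which the innovations
of a given list of times are read give the same joint law. -/
lemma map_two_copies_eq (hε : ∀ k, Measurable (ε k)) (hind : iIndepFun ε μ) {ι : Type*}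
    [Countable ι] (t : ι → ℕ) (a b : ι → Bool)
    (ha : Function.Injective fun i => (a i, t i)) (hb : Function.Injective fun i => (b i, t i)) :
    (μ.prod μ).map (fun (z : Ω × Ω) i => ε (t i) (cond (a i) z.1 z.2)) =
      (μ.prod μ).map (fun (z : Ω × Ω) i => ε (t i) (cond (b i) z.1 z.2)) := by
  have hcond := measurePreserving_cond (μ := μ)
  have h := iIndepFun_two_copies hε hind
  refine (IdentDistrib.pi (fun i => ?_) (h.precomp ha) (h.precomp hb)).map_eq
  have e : ∀ c : Bool, (μ.prod μ).map (fun z : Ω × Ω => ε (t i) (cond c z.1 z.2)) =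
      μ.map (ε (t i)) := fun c => by
    rw [← (hcond c).map_eq, Measure.map_map (hε _) (hcond c).measurable, (hcond c).map_eq]
    rfl
  exact ⟨((hε _).comp (hcond _).measurable).aemeasurable,
    ((hε _).comp (hcond _).measurable).aemeasurable, (e _).trans (e _).symm⟩

lemma map_mix (hε : ∀ k, Measurable (ε k)) (hind : iIndepFun ε μ) (k : ℕ) :
    (μ.prod μ).map (mix ε k) = μ.map (innov ε) := by
  have h := map_two_copies_eq (μ := μ) hε hind (ι := ℕ) id (fun j => decide (j < k))
    (fun _ => true) (fun i j hij => (Prod.ext_iff.1 hij).2) (fun i j hij => (Prod.ext_iff.1 hij).2)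
  have e : mix ε k = fun (z : Ω × Ω) i => ε (id i) (cond (decide (i < k)) z.1 z.2) := by
    funext z j
    by_cases hj : j < k <;> simp [mix, hj]
  rw [e, h]
  exact (Measure.map_map (measurable_innov hε) measurable_fst).symm.trans
    (congrArg (Measure.map (innov ε)) (measurePreserving_fst (μ := μ) (ν := μ)).map_eq)

lemma map_resample (hε : ∀ k, Measurable (ε k)) (hind : iIndepFun ε μ) (k : ℕ) :
    (μ.prod μ).map (resample ε k) = μ.map (innov ε) := by
  have h := map_two_copies_eq (μ := μ) hε hind (ι := ℕ) id (fun j => decide (j ≠ k))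
    (fun _ => true) (fun i j hij => (Prod.ext_iff.1 hij).2) (fun i j hij => (Prod.ext_iff.1 hij).2)
  have e : resample ε k = fun (z : Ω × Ω) i => ε (id i) (cond (decide (i ≠ k)) z.1 z.2) := by
    funext z j
    by_cases hj : j = k
    · subst hj; simp [resample]
    · simp [resample, hj, innov]
  rw [e, h]
  exact (Measure.map_map (measurable_innov hε) measurable_fst).symm.trans
    (congrArg (Measure.map (innov ε)) (measurePreserving_fst (μ := μ) (ν := μ)).map_eq)

/-- Two consecutive hybrid sequences are distributed like the innovations and their copy with one
entry resampled. -/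
lemma map_mix_succ_mix (hε : ∀ k, Measurable (ε k)) (hind : iIndepFun ε μ) (k : ℕ) :
    (μ.prod μ).map (fun z => (mix ε (k + 1) z, mix ε k z)) =
      (μ.prod μ).map (fun z => (innov ε z.1, resample ε k z)) := by
  -- the index `none` stands for the second copy of the innovation `k`
  have h := map_two_copies_eq (μ := μ) hε hind (ι := Option ℕ) (fun o => o.getD k)
    (fun o => o.elim false fun j => decide (j ≤ k)) (fun o => o.elim false fun _ => true)
    (by rintro (_ | i) (_ | j) hij <;> simp_all <;> omega)
    (by rintro (_ | i) (_ | j) hij <;> simp_all)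
  let Φ : (Option ℕ → E) → (ℕ → E) × (ℕ → E) :=
    fun y => (fun j => y (some j), Function.update (fun j => y (some j)) k (y none))
  have hΦ : Measurable Φ := by
    have h1 : Measurable fun (y : Option ℕ → E) (j : ℕ) => y (some j) := by fun_prop
    exact h1.prodMk ((measurable_update_pair k).comp (h1.prodMk (measurable_pi_apply none)))
  have hm : ∀ c : Option ℕ → Bool, Measurable fun (z : Ω × Ω) (o : Option ℕ) =>
      ε (o.getD k) (cond (c o) z.1 z.2) := fun c =>
    measurable_pi_lambda _ fun o => (hε _).comp (measurePreserving_cond (μ := μ) (c o)).measurable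
  have h2 := congrArg (Measure.map Φ) h
  rw [Measure.map_map hΦ (hm _), Measure.map_map hΦ (hm _)] at h2
  have e1 : (fun z => (mix ε (k + 1) z, mix ε k z)) = Φ ∘ fun (z : Ω × Ω) (o : Option ℕ) =>
      ε (o.getD k) (cond (o.elim false fun j => decide (j ≤ k)) z.1 z.2) := by
    funext z
    refine Prod.ext (funext fun j => ?_) (funext fun j => ?_)
    · by_cases hj : j ≤ k <;> simp [Φ, mix, hj]
    · rcases lt_trichotomy j k with hj | rfl | hj
      · simp [Φ, mix, hj, hj.ne, hj.le]
      · simp [Φ, mix]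
      · simp [Φ, mix, hj.ne', hj.not_gt, hj.not_ge]
  have e2 : (fun z => (innov ε z.1, resample ε k z)) = Φ ∘ fun (z : Ω × Ω) (o : Option ℕ) =>
      ε (o.getD k) (cond (o.elim false fun _ => true) z.1 z.2) := rfl
  rw [e1, e2]
  exact h2

end

/-! ### Revealing the innovations one by one -/

section

variable {Ω E : Type*} [m₀ : MeasurableSpace Ω] [mE : MeasurableSpace E]

/-- The filtration that reveals the innovations one by one: the sigma-algebra with index `k` is
generated by the innovations with index less than `k`. -/
def innovFiltration (ε : ℕ → Ω → E) (hε : ∀ k, Measurable (ε k)) : Filtration ℕ m₀ where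
  seq k := ⨆ j, ⨆ (_ : j < k), mE.comap (ε j)
  mono' _ _ h := iSup_mono fun _ => iSup_mono' fun hj => ⟨hj.trans_le h, le_rfl⟩
  le' _ := iSup₂_le fun j _ => (hε j).comap_le

variable {μ : Measure Ω} [IsProbabilityMeasure μ] {ε : ℕ → Ω → E}

lemma measurable_innovFiltration (hε : ∀ k, Measurable (ε k)) {j k : ℕ} (hj : j < k) :
    Measurable[innovFiltration ε hε k] (ε j) :=
  (comap_measurable (ε j)).mono (le_iSup₂_of_le j hj le_rfl) le_rfl

lemma measurable_innov_iSup (hε : ∀ k, Measurable (ε k)) :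
    Measurable[⨆ k, innovFiltration ε hε k] (innov ε) :=
  @measurable_pi_lambda _ _ _ (_) _ _ fun j =>
    (measurable_innovFiltration hε (Nat.lt_succ_self j)).mono
      (le_iSup (fun k => innovFiltration ε hε k) (j + 1)) le_rfl

/-- The first `k` innovations as one random element generate the sigma-algebra with index `k`. -/
lemma innovFiltration_le_comap (hε : ∀ k, Measurable (ε k)) (k : ℕ) :
    innovFiltration ε hε k ≤
      MeasurableSpace.comap (fun ω (j : {j // j < k}) => ε j ω) MeasurableSpace.pi := by
  refine iSup₂_le fun j hj => ?_
  have : ε j = (fun y : {j // j < k} → E => y ⟨j, hj⟩) ∘ fun ω (j : {j // j < k}) => ε j ω := rfl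
  rw [this, ← MeasurableSpace.comap_comp]
  exact MeasurableSpace.comap_mono (measurable_pi_apply _).comap_le

lemma integrable_comp_mix (hε : ∀ k, Measurable (ε k)) (hind : iIndepFun ε μ)
    {f : (ℕ → E) → ℝ} (hf : Measurable f) (hfi : Integrable (f ∘ innov ε) μ) (k : ℕ) :
    Integrable (f ∘ mix ε k) (μ.prod μ) := by
  rw [← integrable_map_measure hf.aestronglyMeasurable (measurable_mix hε k).aemeasurable,
    map_mix hε hind, integrable_map_measure hf.aestronglyMeasurable
      (measurable_innov hε).aemeasurable]
  exact hfi

/-- Conditioning a function of the innovations on the first `k` of them amounts to integrating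
over an independent copy of the others. -/
theorem condExp_innovFiltration (hε : ∀ k, Measurable (ε k)) (hind : iIndepFun ε μ)
    {f : (ℕ → E) → ℝ} (hf : Measurable f) (hfi : Integrable (f ∘ innov ε) μ) (k : ℕ) :
    μ[f ∘ innov ε | innovFiltration ε hε k] =ᵐ[μ] fun ω => ∫ ω', f (mix ε k (ω, ω')) ∂μ := by
  have hmi := integrable_comp_mix hε hind hf hfi k
  symm
  refine ae_eq_condExp_of_forall_setIntegral_eq ((innovFiltration ε hε).le k) hfi
    (fun s _ _ => hmi.integral_prod_left.integrableOn) (fun s hs _ => ?_) ?_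
  · obtain ⟨B, hB, rfl⟩ := innovFiltration_le_comap hε k s hs
    set U : Ω → {j // j < k} → E := fun ω j => ε j ω with hU
    have hUm : Measurable U := measurable_pi_lambda _ fun j => hε j
    have hV : Measurable fun (y : ℕ → E) (j : {j // j < k}) => y j := by fun_prop
    set B' : Set (ℕ → E) := (fun (y : ℕ → E) (j : {j // j < k}) => y j) ⁻¹' B with hB'
    have hB'm : MeasurableSet B' := hV hB
    have hg : Measurable (B'.indicator f) := hf.indicator hB'm
    have e1 : ∫ ω in U ⁻¹' B, (f ∘ innov ε) ω ∂μ = ∫ y, B'.indicator f y ∂(μ.map (innov ε)) := by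
      rw [integral_map (measurable_innov hε).aemeasurable hg.aestronglyMeasurable,
        ← integral_indicator (hUm hB)]
      rfl
    have e2 : ∀ z : Ω × Ω, B'.indicator f (mix ε k z) =
        (U ⁻¹' B).indicator (fun ω => f (mix ε k (ω, z.2))) z.1 := fun z => by
      have : mix ε k z ∈ B' ↔ z.1 ∈ U ⁻¹' B := by
        have : (fun j : {j // j < k} => mix ε k z j) = U z.1 := by
          funext j; simp [mix, j.2, hU]
        simp only [hB', Set.mem_preimage, this]
      by_cases h : z.1 ∈ U ⁻¹' B
      · rw [Set.indicator_of_mem (this.2 h), Set.indicator_of_mem h]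
      · rw [Set.indicator_of_notMem (mt this.1 h), Set.indicator_of_notMem h]
    rw [e1, ← map_mix hε hind k, integral_map (measurable_mix hε k).aemeasurable
      hg.aestronglyMeasurable, integral_prod, ← integral_indicator (hUm hB)]
    · refine integral_congr_ae (ae_of_all _ fun ω => ?_)
      simp only [e2]
      by_cases h : ω ∈ U ⁻¹' B
      · simp only [Set.indicator_of_mem h]
      · simp only [Set.indicator_of_notMem h, integral_zero]
    · have : (fun z => B'.indicator f (mix ε k z)) =
          (mix ε k ⁻¹' B').indicator (f ∘ mix ε k) := rfl
      rw [this]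
      exact hmi.indicator (measurable_mix hε k hB'm)
  · let Ψ : ({j // j < k} → E) × Ω → ℕ → E :=
      fun y j => if h : j < k then y.1 ⟨j, h⟩ else ε j y.2
    have hΨ : Measurable Ψ := by
      refine measurable_pi_lambda _ fun j => ?_
      by_cases h : j < k
      · simp only [Ψ, h, dif_pos]
        exact (measurable_pi_apply _).comp measurable_fst
      · simp only [Ψ, h, dif_neg, not_false_iff]
        exact (hε j).comp measurable_snd
    have h1 : StronglyMeasurable fun u : {j // j < k} → E => ∫ ω', f (Ψ (u, ω')) ∂μ :=
      (hf.comp hΨ).stronglyMeasurable.integral_prod_right'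
    have h2 : Measurable[innovFiltration ε hε k] fun ω (j : {j // j < k}) => ε j ω :=
      @measurable_pi_lambda _ _ _ (_) _ _ fun j => measurable_innovFiltration hε j.2
    have h3 := h1.comp_measurable h2
    refine StronglyMeasurable.aestronglyMeasurable ?_
    convert h3 using 1
    funext ω
    have : ∀ ω', mix ε k (ω, ω') = Ψ (fun j => ε j ω, ω') := fun ω' => by
      funext j
      by_cases h : j < k <;> simp [mix, Ψ, h]
    simp only [this, Function.comp_def]

/-- The influence of the innovation `k` on the function `f` of the innovations: the `L^q` distance
between `f` and its value after resampling that innovation. -/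
noncomputable def influence (μ : Measure Ω) (ε : ℕ → Ω → E) (f : (ℕ → E) → ℝ) (k : ℕ)
    (q : ℝ≥0∞) : ℝ≥0∞ :=
  eLpNorm (fun z : Ω × Ω => f (innov ε z.1) - f (resample ε k z)) q (μ.prod μ)

lemma eLpNorm_mix_succ_sub (hε : ∀ k, Measurable (ε k)) (hind : iIndepFun ε μ)
    {f : (ℕ → E) → ℝ} (hf : Measurable f) (k : ℕ) (q : ℝ≥0∞) :
    eLpNorm (fun z => f (mix ε (k + 1) z) - f (mix ε k z)) q (μ.prod μ) =
      influence μ ε f k q := by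
  have hg : Measurable fun y : (ℕ → E) × (ℕ → E) => f y.1 - f y.2 :=
    (hf.comp measurable_fst).sub (hf.comp measurable_snd)
  have h1 := eLpNorm_map_measure (p := q) (μ := μ.prod μ)
    (f := fun z => (mix ε (k + 1) z, mix ε k z)) hg.aestronglyMeasurable
    ((measurable_mix hε _).prodMk (measurable_mix hε _)).aemeasurable
  have h2 := eLpNorm_map_measure (p := q) (μ := μ.prod μ)
    (f := fun z => (innov ε z.1, resample ε k z)) hg.aestronglyMeasurable
    (((measurable_innov hε).comp measurable_fst).prodMk (measurable_resample hε _)).aemeasurable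
  rw [map_mix_succ_mix hε hind] at h1
  exact h1.symm.trans h2

/-- Jensen's inequality for integration over one factor of a product of probability spaces. -/
lemma eLpNorm_integral_prod_le {q : ℝ} (hq : 1 ≤ q) {h : Ω × Ω → ℝ} (hh : Measurable h) :
    eLpNorm (fun ω => ∫ ω', h (ω, ω') ∂μ) (ENNReal.ofReal q) μ ≤
      eLpNorm h (ENNReal.ofReal q) (μ.prod μ) := by
  have hq0 : 0 < q := by linarith
  rw [← ENNReal.rpow_le_rpow_iff hq0, ← lintegral_enorm_rpow_eq_eLpNorm_rpow hq0,
    ← lintegral_enorm_rpow_eq_eLpNorm_rpow hq0, lintegral_prod _ (by fun_prop)]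
  refine lintegral_mono fun ω => ?_
  calc ‖∫ ω', h (ω, ω') ∂μ‖ₑ ^ q ≤ (∫⁻ ω', ‖h (ω, ω')‖ₑ ∂μ) ^ q := by
        gcongr; exact enorm_integral_le_lintegral_enorm _
    _ = eLpNorm (fun ω' => h (ω, ω')) 1 μ ^ q := by rw [eLpNorm_one_eq_lintegral_enorm]
    _ ≤ eLpNorm (fun ω' => h (ω, ω')) (ENNReal.ofReal q) μ ^ q := by
        gcongr
        exact eLpNorm_le_eLpNorm_of_exponent_le (by simpa using hq)
          (hh.comp measurable_prodMk_left).aestronglyMeasurable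
    _ = _ := (lintegral_enorm_rpow_eq_eLpNorm_rpow hq0 _).symm

/-- The martingale increment obtained by revealing one innovation is bounded by the influence of
that innovation. -/
theorem eLpNorm_condExp_succ_sub_le (hε : ∀ k, Measurable (ε k)) (hind : iIndepFun ε μ)
    {f : (ℕ → E) → ℝ} (hf : Measurable f) (hfi : Integrable (f ∘ innov ε) μ) {q : ℝ} (hq : 1 ≤ q)
    (k : ℕ) :
    eLpNorm (μ[f ∘ innov ε | innovFiltration ε hε (k + 1)] -
      μ[f ∘ innov ε | innovFiltration ε hε k]) (ENNReal.ofReal q) μ ≤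
      influence μ ε f k (ENNReal.ofReal q) := by
  rw [← eLpNorm_mix_succ_sub hε hind hf]
  refine le_trans (le_of_eq (eLpNorm_congr_ae ?_)) (eLpNorm_integral_prod_le hq
    ((hf.comp (measurable_mix hε _)).sub (hf.comp (measurable_mix hε _))))
  filter_upwards [condExp_innovFiltration hε hind hf hfi (k + 1),
    condExp_innovFiltration hε hind hf hfi k,
    (integrable_comp_mix hε hind hf hfi (k + 1)).prod_right_ae,
    (integrable_comp_mix hε hind hf hfi k).prod_right_ae] with ω h1 h2 h3 h4
  rw [Pi.sub_apply, h1, h2]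
  exact (integral_sub h3 h4).symm

end

/-! ### Moment inequality of Efron–Stein type -/

section

section

variable {Ω E : Type*} [m₀ : MeasurableSpace Ω] {μ : Measure Ω} {ε : ℕ → Ω → E}

/-- The influence is subadditive over sums of functions. -/
lemma influence_sum_le [MeasurableSpace E] (hε : ∀ k, Measurable (ε k)) {ι : Type*} (s : Finset ι)
    {f : ι → (ℕ → E) → ℝ} (hf : ∀ i ∈ s, Measurable (f i)) (k : ℕ) {q : ℝ≥0∞} (hq : 1 ≤ q) :
    influence μ ε (fun y => ∑ i ∈ s, f i y) k q ≤ ∑ i ∈ s, influence μ ε (f i) k q := by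
  unfold influence
  simp only [← Finset.sum_sub_distrib]
  refine le_trans (le_of_eq ?_) (eLpNorm_sum_le (f := fun i (z : Ω × Ω) =>
    f i (innov ε z.1) - f i (resample ε k z)) (fun i hi => ?_) hq)
  · congr 1; funext z; simp
  · exact (((hf i hi).comp ((measurable_innov hε).comp measurable_fst)).sub
      ((hf i hi).comp (measurable_resample hε k))).aestronglyMeasurable

end

variable {Ω E : Type*} [m₀ : MeasurableSpace Ω] [mE : MeasurableSpace E]
  {μ : Measure Ω} [IsProbabilityMeasure μ] {ε : ℕ → Ω → E}

lemma condExp_innovFiltration_zero (hε : ∀ k, Measurable (ε k)) (f : (ℕ → E) → ℝ) :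
    μ[f ∘ innov ε | innovFiltration ε hε 0] = fun _ => ∫ ω, f (innov ε ω) ∂μ := by
  have : (innovFiltration ε hε 0 : MeasurableSpace Ω) = ⊥ := by simp [innovFiltration]
  rw [this, condExp_bot]
  rfl

lemma tendsto_condExp_innovFiltration (hε : ∀ k, Measurable (ε k)) {f : (ℕ → E) → ℝ}
    (hf : Measurable f) (hfi : Integrable (f ∘ innov ε) μ) :
    ∀ᵐ ω ∂μ, Tendsto (fun k => (μ[f ∘ innov ε | innovFiltration ε hε k]) ω) atTop
      (𝓝 (f (innov ε ω))) := by
  have h := tendsto_ae_condExp (μ := μ) (ℱ := innovFiltration ε hε) (f ∘ innov ε)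
  have hle : (⨆ k, innovFiltration ε hε k : MeasurableSpace Ω) ≤ m₀ :=
    iSup_le (innovFiltration ε hε).le
  have e := condExp_of_stronglyMeasurable (μ := μ) hle
    (hf.comp (measurable_innov_iSup hε)).stronglyMeasurable hfi
  rw [e] at h
  exact h

/-- The increments of the martingale that reveals the innovations one by one have conditional mean
zero given any earlier stage. -/
lemma condExp_increment_eq_zero (hε : ∀ k, Measurable (ε k)) {Z : Ω → ℝ} {k l : ℕ} (hkl : k ≤ l) :
    μ[μ[Z | innovFiltration ε hε (l + 1)] - μ[Z | innovFiltration ε hε l] |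
      innovFiltration ε hε k] =ᵐ[μ] 0 := by
  have h1 := condExp_condExp_of_le (μ := μ) (f := Z) ((innovFiltration ε hε).mono
    (hkl.trans l.le_succ)) ((innovFiltration ε hε).le (l + 1))
  have h2 := condExp_condExp_of_le (μ := μ) (f := Z) ((innovFiltration ε hε).mono hkl)
    ((innovFiltration ε hε).le l)
  filter_upwards [condExp_sub (μ := μ) (f := μ[Z | innovFiltration ε hε (l + 1)])
    (g := μ[Z | innovFiltration ε hε l])
    integrable_condExp integrable_condExp (innovFiltration ε hε k), h1, h2] with ω h3 h4 h5
  rw [h3, Pi.sub_apply, h4, h5, sub_self, Pi.zero_apply]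

/-- The martingale between the stages `K` and `K + J`, by adding one increment at a time. -/
lemma eLpNorm_condExp_sub_sq_le (hε : ∀ k, Measurable (ε k)) (hind : iIndepFun ε μ)
    {f : (ℕ → E) → ℝ} (hf : Measurable f) {q : ℝ} (hq : 2 ≤ q)
    (hfq : MemLp (f ∘ innov ε) (ENNReal.ofReal q) μ) (K J : ℕ) :
    eLpNorm (μ[f ∘ innov ε | innovFiltration ε hε (K + J)] -
      μ[f ∘ innov ε | innovFiltration ε hε K]) (ENNReal.ofReal q) μ ^ 2 ≤
      martConst q * ∑ k ∈ Finset.range J, influence μ ε f (k + K) (ENNReal.ofReal q) ^ 2 := by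
  have hq1 : 1 ≤ ENNReal.ofReal q := by simpa using (by linarith : (1 : ℝ) ≤ q)
  have hfi : Integrable (f ∘ innov ε) μ := hfq.integrable hq1
  set M := fun k => μ[f ∘ innov ε | innovFiltration ε hε k] with hM
  have hMq : ∀ k, MemLp (M k) (ENNReal.ofReal q) μ := fun k => hfq.condExp hq1
  have hMm : ∀ {k l : ℕ}, k ≤ l → StronglyMeasurable[innovFiltration ε hε l] (M k) := fun h =>
    stronglyMeasurable_condExp.mono ((innovFiltration ε hε).mono h)
  induction J with
  | zero => simp
  | succ J ih =>
    have hsplit : M (K + (J + 1)) - M K = (M (K + J) - M K) + (M (K + J + 1) - M (K + J)) := by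
      rw [← add_assoc]; abel
    have h := eLpNorm_add_sq_le hq ((innovFiltration ε hε).le (K + J))
      ((hMq (K + J)).sub (hMq K)) ((hMm le_rfl).sub (hMm (Nat.le_add_right K J)))
      ((hMq (K + J + 1)).sub (hMq (K + J))) (condExp_increment_eq_zero hε le_rfl)
    change eLpNorm (M (K + (J + 1)) - M K) _ _ ^ 2 ≤ _
    rw [hsplit, Finset.sum_range_succ, mul_add]
    refine h.trans (add_le_add ih ?_)
    gcongr
    rw [add_comm J K]
    exact eLpNorm_condExp_succ_sub_le hε hind hf hfi (by linarith) _

/-- The tail of the martingale that reveals the innovations one by one is controlled in `L^q` by the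
influences of the innovations not yet revealed. -/
theorem eLpNorm_sub_condExp_sq_le (hε : ∀ k, Measurable (ε k)) (hind : iIndepFun ε μ)
    {f : (ℕ → E) → ℝ} (hf : Measurable f) {q : ℝ} (hq : 2 ≤ q)
    (hfq : MemLp (f ∘ innov ε) (ENNReal.ofReal q) μ) (K : ℕ) :
    eLpNorm (f ∘ innov ε - μ[f ∘ innov ε | innovFiltration ε hε K]) (ENNReal.ofReal q) μ ^ 2 ≤
      martConst q * ∑' k, influence μ ε f (k + K) (ENNReal.ofReal q) ^ 2 := by
  have hfi : Integrable (f ∘ innov ε) μ :=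
    hfq.integrable (by simpa using (by linarith : (1 : ℝ) ≤ q))
  -- Lévy's upward theorem and Fatou's lemma pass from finitely many increments to the limit
  set R := (martConst q : ℝ≥0∞) * ∑' k, influence μ ε f (k + K) (ENNReal.ofReal q) ^ 2
  have hbound : ∀ J, eLpNorm (μ[f ∘ innov ε | innovFiltration ε hε (K + J)] -
      μ[f ∘ innov ε | innovFiltration ε hε K]) (ENNReal.ofReal q) μ ≤ R ^ (1 / 2 : ℝ) := fun J => by
    rw [one_div, ENNReal.le_rpow_inv_iff (by norm_num)]
    refine le_trans (le_of_eq ?_) ((eLpNorm_condExp_sub_sq_le hε hind hf hq hfq K J).trans ?_)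
    · norm_num
    · exact mul_le_mul_right (ENNReal.sum_le_tsum _) _
  have hlim := Lp.eLpNorm_lim_le_liminf_eLpNorm (μ := μ) (p := ENNReal.ofReal q)
    (f := fun J => μ[f ∘ innov ε | innovFiltration ε hε (K + J)] -
      μ[f ∘ innov ε | innovFiltration ε hε K])
    (fun J => (integrable_condExp.sub integrable_condExp).1)
    (f ∘ innov ε - μ[f ∘ innov ε | innovFiltration ε hε K]) (by
      filter_upwards [tendsto_condExp_innovFiltration hε hf hfi] with ω hω
      exact ((tendsto_add_atTop_iff_nat K).2 hω |>.congr fun J => by rw [add_comm]).sub_const _)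
  have h2 : atTop.liminf (fun J => eLpNorm (μ[f ∘ innov ε | innovFiltration ε hε (K + J)] -
      μ[f ∘ innov ε | innovFiltration ε hε K]) (ENNReal.ofReal q) μ) ≤ R ^ (1 / 2 : ℝ) :=
    (liminf_le_liminf (Eventually.of_forall hbound)).trans (by simp)
  calc _ ≤ (R ^ (1 / 2 : ℝ)) ^ 2 := by gcongr; exact hlim.trans h2
    _ = R := by rw [← ENNReal.rpow_natCast, ← ENNReal.rpow_mul]; norm_num

/-- The moment version of the Efron–Stein inequality. -/
theorem eLpNorm_sub_integral_sq_le (hε : ∀ k, Measurable (ε k)) (hind : iIndepFun ε μ)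
    {f : (ℕ → E) → ℝ} (hf : Measurable f) {q : ℝ} (hq : 2 ≤ q)
    (hfq : MemLp (f ∘ innov ε) (ENNReal.ofReal q) μ) :
    eLpNorm (fun ω => f (innov ε ω) - ∫ ω', f (innov ε ω') ∂μ) (ENNReal.ofReal q) μ ^ 2 ≤
      martConst q * ∑' k, influence μ ε f k (ENNReal.ofReal q) ^ 2 := by
  have h := eLpNorm_sub_condExp_sq_le hε hind hf hq hfq 0
  rw [condExp_innovFiltration_zero] at h
  exact h

lemma eLpNorm_comp_resample (hε : ∀ k, Measurable (ε k)) (hind : iIndepFun ε μ)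
    {f : (ℕ → E) → ℝ} (hf : Measurable f) (k : ℕ) (q : ℝ≥0∞) :
    eLpNorm (fun z => f (resample ε k z)) q (μ.prod μ) = eLpNorm (f ∘ innov ε) q μ := by
  have h := eLpNorm_map_measure (p := q) (μ := μ.prod μ) (f := resample ε k)
    hf.aestronglyMeasurable (measurable_resample hε k).aemeasurable
  rw [map_resample hε hind, eLpNorm_map_measure hf.aestronglyMeasurable
    (measurable_innov hε).aemeasurable] at h
  exact h.symm

/-- A Leibniz rule for the influence on a product. -/
lemma influence_mul_le (hε : ∀ k, Measurable (ε k)) (hind : iIndepFun ε μ)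
    {f g : (ℕ → E) → ℝ} (hf : Measurable f) (hg : Measurable g) (k : ℕ) {p r : ℝ≥0∞} (hr : 1 ≤ r)
    [ENNReal.HolderTriple p p r] :
    influence μ ε (fun y => f y * g y) k r ≤
      eLpNorm (f ∘ innov ε) p μ * influence μ ε g k p +
        influence μ ε f k p * eLpNorm (g ∘ innov ε) p μ := by
  have mi : Measurable fun z : Ω × Ω => innov ε z.1 := (measurable_innov hε).comp measurable_fst
  have mr := measurable_resample hε k
  have h1 : AEStronglyMeasurable (fun z : Ω × Ω => f (innov ε z.1)) (μ.prod μ) :=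
    (hf.comp mi).aestronglyMeasurable
  have h2 : AEStronglyMeasurable (fun z : Ω × Ω => g (innov ε z.1) - g (resample ε k z))
    (μ.prod μ) := ((hg.comp mi).sub (hg.comp mr)).aestronglyMeasurable
  have h3 : AEStronglyMeasurable (fun z : Ω × Ω => f (innov ε z.1) - f (resample ε k z))
    (μ.prod μ) := ((hf.comp mi).sub (hf.comp mr)).aestronglyMeasurable
  have h4 : AEStronglyMeasurable (fun z : Ω × Ω => g (resample ε k z)) (μ.prod μ) :=
    (hg.comp mr).aestronglyMeasurable
  have e1 : eLpNorm (fun z : Ω × Ω => f (innov ε z.1)) p (μ.prod μ) =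
      eLpNorm (f ∘ innov ε) p μ :=
    eLpNorm_comp_measurePreserving (g := f ∘ innov ε)
      (hf.comp (measurable_innov hε)).aestronglyMeasurable measurePreserving_fst
  have split : (fun z : Ω × Ω => f (innov ε z.1) * g (innov ε z.1) -
      f (resample ε k z) * g (resample ε k z)) =
      (fun z : Ω × Ω => f (innov ε z.1)) •
        (fun z : Ω × Ω => g (innov ε z.1) - g (resample ε k z)) +
      (fun z : Ω × Ω => f (innov ε z.1) - f (resample ε k z)) •
        (fun z : Ω × Ω => g (resample ε k z)) := by
    funext z; simp only [Pi.add_apply, smul_eq_mul, Pi.mul_apply]; ring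
  unfold influence
  rw [split]
  refine (eLpNorm_add_le (h1.smul h2) (h3.smul h4) hr).trans (add_le_add ?_ ?_)
  · rw [← e1]
    exact eLpNorm_smul_le_mul_eLpNorm h2 h1
  · rw [← eLpNorm_comp_resample hε hind hg k]
    exact eLpNorm_smul_le_mul_eLpNorm h4 h3

end

/-! ### Covariance inequality -/

section

lemma enorm_integral_mul_le {Ω : Type*} {m₀ : MeasurableSpace Ω} {μ : Measure Ω}
    {X Y : Ω → ℝ} (hX : MemLp X 2 μ) (hY : MemLp Y 2 μ) :
    ‖∫ ω, X ω * Y ω ∂μ‖ₑ ≤ eLpNorm X 2 μ * eLpNorm Y 2 μ := by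
  refine (enorm_integral_le_lintegral_enorm _).trans ?_
  rw [← eLpNorm_one_eq_lintegral_enorm]
  have h : eLpNorm (X • Y) 1 μ ≤ eLpNorm X 2 μ * eLpNorm Y 2 μ :=
    eLpNorm_smul_le_mul_eLpNorm (p := 2) (q := 2) (r := 1) hY.1 hX.1
  exact h

variable {Ω E : Type*} [m₀ : MeasurableSpace Ω] [mE : MeasurableSpace E]
  {μ : Measure Ω} [IsProbabilityMeasure μ] {ε : ℕ → Ω → E}

lemma integral_mul_increment_eq_zero {m : MeasurableSpace Ω} (hm : m ≤ m₀) {X Y : Ω → ℝ}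
    (hX : MemLp X 2 μ) (hXm : StronglyMeasurable[m] X) (hY : MemLp Y 2 μ)
    (hY0 : μ[Y | m] =ᵐ[μ] 0) : ∫ ω, X ω * Y ω ∂μ = 0 := by
  have h2 : ENNReal.ofReal 2 = 2 := by norm_num
  have h := (integral_signedPow_mul_eq_zero le_rfl hm (h2 ▸ hX) hXm (h2 ▸ hY) hY0).2
  simpa [signedPow] using h

/-- The covariance of the conditional expectations given the first `K` innovations is bounded by the
sum of the products of the influences. -/
lemma enorm_integral_condExp_mul_sub_le (hε : ∀ k, Measurable (ε k)) (hind : iIndepFun ε μ)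
    {f g : (ℕ → E) → ℝ} (hf : Measurable f) (hg : Measurable g)
    (hf2 : MemLp (f ∘ innov ε) 2 μ) (hg2 : MemLp (g ∘ innov ε) 2 μ) (K : ℕ) :
    ‖∫ ω, (μ[f ∘ innov ε | innovFiltration ε hε K]) ω *
        (μ[g ∘ innov ε | innovFiltration ε hε K]) ω ∂μ -
      (∫ ω, f (innov ε ω) ∂μ) * ∫ ω, g (innov ε ω) ∂μ‖ₑ ≤
      ∑ k ∈ Finset.range K, influence μ ε f k 2 * influence μ ε g k 2 := by
  have hf1 : Integrable (f ∘ innov ε) μ := hf2.integrable (by norm_num)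
  have hg1 : Integrable (g ∘ innov ε) μ := hg2.integrable (by norm_num)
  have h2 : ENNReal.ofReal 2 = 2 := by norm_num
  set M := fun k => μ[f ∘ innov ε | innovFiltration ε hε k] with hM
  set N := fun k => μ[g ∘ innov ε | innovFiltration ε hε k] with hN
  have hM2 : ∀ k, MemLp (M k) 2 μ := fun k => hf2.condExp (by norm_num)
  have hN2 : ∀ k, MemLp (N k) 2 μ := fun k => hg2.condExp (by norm_num)
  induction K with
  | zero =>
    rw [condExp_innovFiltration_zero, condExp_innovFiltration_zero]
    simp
  | succ K ih =>
    have c1 : ∫ ω, M K ω * (N (K + 1) - N K) ω ∂μ = 0 :=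
      integral_mul_increment_eq_zero ((innovFiltration ε hε).le K) (hM2 K)
        stronglyMeasurable_condExp ((hN2 _).sub (hN2 _)) (condExp_increment_eq_zero hε le_rfl)
    have c2 : ∫ ω, N K ω * (M (K + 1) - M K) ω ∂μ = 0 :=
      integral_mul_increment_eq_zero ((innovFiltration ε hε).le K) (hN2 K)
        stronglyMeasurable_condExp ((hM2 _).sub (hM2 _)) (condExp_increment_eq_zero hε le_rfl)
    have i0 : Integrable (fun ω => M K ω * N K ω) μ := (hM2 K).integrable_mul (hN2 K)
    have i1 : Integrable (fun ω => M K ω * (N (K + 1) - N K) ω) μ :=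
      (hM2 K).integrable_mul ((hN2 (K + 1)).sub (hN2 K))
    have i2 : Integrable (fun ω => N K ω * (M (K + 1) - M K) ω) μ :=
      (hN2 K).integrable_mul ((hM2 (K + 1)).sub (hM2 K))
    have i3 : Integrable (fun ω => (M (K + 1) - M K) ω * (N (K + 1) - N K) ω) μ :=
      ((hM2 (K + 1)).sub (hM2 K)).integrable_mul ((hN2 (K + 1)).sub (hN2 K))
    have i4 : Integrable (fun ω => M K ω * N K ω + M K ω * (N (K + 1) - N K) ω) μ := i0.add i1
    have i5 : Integrable (fun ω => M K ω * N K ω + M K ω * (N (K + 1) - N K) ω +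
      N K ω * (M (K + 1) - M K) ω) μ := i4.add i2
    have split : ∫ ω, M (K + 1) ω * N (K + 1) ω ∂μ = ∫ ω, M K ω * N K ω ∂μ +
        ∫ ω, (M (K + 1) - M K) ω * (N (K + 1) - N K) ω ∂μ := by
      calc _ = ∫ ω, (M K ω * N K ω + M K ω * (N (K + 1) - N K) ω +
            N K ω * (M (K + 1) - M K) ω + (M (K + 1) - M K) ω * (N (K + 1) - N K) ω) ∂μ := by
            congr 1; funext ω; simp only [Pi.sub_apply]; ring
        _ = _ := by
          rw [integral_add i5 i3, integral_add i4 i2, integral_add i0 i1, c1, c2]; ring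
    change ‖∫ ω, M (K + 1) ω * N (K + 1) ω ∂μ - _‖ₑ ≤ _
    rw [split, add_sub_right_comm, Finset.sum_range_succ]
    refine (enorm_add_le _ _).trans (add_le_add ih ?_)
    refine (enorm_integral_mul_le ((hM2 _).sub (hM2 _)) ((hN2 _).sub (hN2 _))).trans ?_
    have b1 := eLpNorm_condExp_succ_sub_le hε hind hf hf1 (one_le_two (α := ℝ)) K
    have b2 := eLpNorm_condExp_succ_sub_le hε hind hg hg1 (one_le_two (α := ℝ)) K
    rw [h2] at b1 b2
    exact mul_le_mul' b1 b2

/-- The covariance of two functions of the innovations is bounded by the sum, over the innovations,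
of the products of their influences. -/
theorem enorm_covariance_le (hε : ∀ k, Measurable (ε k)) (hind : iIndepFun ε μ)
    {f g : (ℕ → E) → ℝ} (hf : Measurable f) (hg : Measurable g)
    (hf2 : MemLp (f ∘ innov ε) 2 μ) (hg2 : MemLp (g ∘ innov ε) 2 μ)
    (hsum : ∑' k, influence μ ε f k 2 ^ 2 ≠ ∞) :
    ‖covariance (f ∘ innov ε) (g ∘ innov ε) μ‖ₑ ≤
      ∑' k, influence μ ε f k 2 * influence μ ε g k 2 := by
  have h2 : ENNReal.ofReal 2 = 2 := by norm_num
  set S := f ∘ innov ε with hS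
  set T := g ∘ innov ε with hT
  set M := fun k => μ[S | innovFiltration ε hε k] with hM
  set N := fun k => μ[T | innovFiltration ε hε k] with hN
  have hM2 : ∀ k, MemLp (M k) 2 μ := fun k => hf2.condExp (by norm_num)
  have hN2 : ∀ k, MemLp (N k) 2 μ := fun k => hg2.condExp (by norm_num)
  have hbound : ∀ K, ‖covariance S T μ‖ₑ ≤ ∑' k, influence μ ε f k 2 * influence μ ε g k 2 +
      eLpNorm (S - M K) 2 μ * eLpNorm T 2 μ := fun K => by
    -- up to the remainder `S - M K`, the covariance is that of the stage `K` of both martingales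
    have z : ∫ ω, M K ω * (T - N K) ω ∂μ = 0 := by
      refine integral_mul_increment_eq_zero ((innovFiltration ε hε).le K) (hM2 K)
        stronglyMeasurable_condExp (hg2.sub (hN2 K)) ?_
      filter_upwards [condExp_sub (μ := μ) (hg2.integrable (by norm_num))
        (integrable_condExp (f := T) (m := innovFiltration ε hε K)) (innovFiltration ε hε K),
        condExp_condExp_of_le (μ := μ) (f := T) le_rfl ((innovFiltration ε hε).le K)] with ω h3 h4
      rw [h3, Pi.sub_apply, h4, sub_self, Pi.zero_apply]
    have i0 : Integrable (fun ω => M K ω * N K ω) μ := (hM2 K).integrable_mul (hN2 K)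
    have i1 : Integrable (fun ω => M K ω * (T - N K) ω) μ :=
      (hM2 K).integrable_mul (hg2.sub (hN2 K))
    have i2 : Integrable (fun ω => (S - M K) ω * T ω) μ := (hf2.sub (hM2 K)).integrable_mul hg2
    have i3 : Integrable (fun ω => M K ω * N K ω + M K ω * (T - N K) ω) μ := i0.add i1
    have e : covariance S T μ = (∫ ω, M K ω * N K ω ∂μ - (∫ ω, S ω ∂μ) * ∫ ω, T ω ∂μ) +
        ∫ ω, (S - M K) ω * T ω ∂μ := by
      rw [covariance_eq_sub hf2 hg2]
      have : ∫ ω, (S * T) ω ∂μ = ∫ ω, M K ω * N K ω ∂μ + ∫ ω, (S - M K) ω * T ω ∂μ := by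
        calc _ = ∫ ω, (M K ω * N K ω + M K ω * (T - N K) ω + (S - M K) ω * T ω) ∂μ := by
              congr 1; funext ω; simp only [Pi.sub_apply, Pi.mul_apply]; ring
          _ = _ := by rw [integral_add i3 i2, integral_add i0 i1, z, add_zero]
      rw [this]; ring
    rw [e]
    refine (enorm_add_le _ _).trans (add_le_add ?_ (enorm_integral_mul_le (hf2.sub (hM2 K)) hg2))
    exact (enorm_integral_condExp_mul_sub_le hε hind hf hg hf2 hg2 K).trans (ENNReal.sum_le_tsum _)
  -- the remainder vanishes, because the influences of `f` are square summable
  have hlim : Tendsto (fun K => eLpNorm (S - M K) 2 μ) atTop (𝓝 0) := by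
    have h0 : Tendsto (fun K => (martConst 2 : ℝ≥0∞) * ∑' k, influence μ ε f (k + K) 2 ^ 2)
        atTop (𝓝 0) := by
      have := ENNReal.Tendsto.const_mul (a := (martConst 2 : ℝ≥0∞))
        (ENNReal.tendsto_sum_nat_add _ hsum) (Or.inr ENNReal.coe_ne_top)
      rwa [mul_zero] at this
    have h1 : Tendsto (fun K => eLpNorm (S - M K) 2 μ ^ 2) atTop (𝓝 0) := by
      refine tendsto_of_tendsto_of_tendsto_of_le_of_le tendsto_const_nhds h0
        (fun _ => zero_le) fun K => ?_
      have := eLpNorm_sub_condExp_sq_le hε hind hf le_rfl (h2.symm ▸ hf2) K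
      rwa [h2] at this
    have h3 := (ENNReal.continuous_rpow_const (y := (1 / 2 : ℝ))).tendsto 0 |>.comp h1
    rw [ENNReal.zero_rpow_of_pos (by norm_num)] at h3
    refine h3.congr fun K => ?_
    rw [Function.comp_apply, ← ENNReal.rpow_natCast, ← ENNReal.rpow_mul]; norm_num
  have hlim2 : Tendsto (fun K => ∑' k, influence μ ε f k 2 * influence μ ε g k 2 +
      eLpNorm (S - M K) 2 μ * eLpNorm T 2 μ) atTop
      (𝓝 (∑' k, influence μ ε f k 2 * influence μ ε g k 2)) := by
    have := (ENNReal.Tendsto.mul_const hlim (Or.inr hg2.2.ne)).const_add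
      (∑' k, influence μ ε f k 2 * influence μ ε g k 2)
    rwa [zero_mul, add_zero] at this
  exact ge_of_tendsto' hlim2 hbound

end

/-! ### Sums of dependence coefficients -/

/-- Extension by zero of a sequence indexed by nonnegative lags to all integer lags. -/
noncomputable def lagExt (ϑ : ℕ → ℝ≥0∞) (z : ℤ) : ℝ≥0∞ := if 0 ≤ z then ϑ z.toNat else 0

lemma lagExt_natCast (ϑ : ℕ → ℝ≥0∞) (m : ℕ) : lagExt ϑ (m : ℤ) = ϑ m := by simp [lagExt]

lemma lagExt_of_neg (ϑ : ℕ → ℝ≥0∞) {z : ℤ} (hz : z < 0) : lagExt ϑ z = 0 := by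
  simp [lagExt, hz]

lemma tsum_lagExt (ϑ : ℕ → ℝ≥0∞) : ∑' z, lagExt ϑ z = ∑' m, ϑ m := by
  rw [← Function.Injective.tsum_eq (g := ((↑) : ℕ → ℤ)) Nat.cast_injective]
  · simp only [lagExt_natCast]
  · intro z hz
    have : 0 ≤ z := by
      by_contra h
      exact hz (lagExt_of_neg ϑ (not_le.1 h))
    exact ⟨z.toNat, Int.toNat_of_nonneg this⟩

lemma tsum_lagExt_comp_le (ϑ : ℕ → ℝ≥0∞) {φ : ℕ → ℤ} (hφ : Function.Injective φ) :
    ∑' k, lagExt ϑ (φ k) ≤ ∑' m, ϑ m :=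
  (ENNReal.tsum_comp_le_tsum_of_injective hφ _).trans (tsum_lagExt ϑ).le

/-- The total influence bound at the innovation `k`, counted backwards from time `n`, for a sum over
the times in `P`. -/
noncomputable def lagSum (ϑ : ℕ → ℝ≥0∞) (n : ℕ) (P : Finset ℕ) (k : ℕ) : ℝ≥0∞ :=
  ∑ a ∈ P, lagExt ϑ ((a : ℤ) - n + k)

lemma lagSum_le (ϑ : ℕ → ℝ≥0∞) (n : ℕ) (P : Finset ℕ) (k : ℕ) :
    lagSum ϑ n P k ≤ ∑' m, ϑ m :=
  (ENNReal.sum_le_tsum _).trans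
    (tsum_lagExt_comp_le ϑ (φ := fun a : ℕ => (a : ℤ) - n + k) fun a b h => by
      simpa using h)

lemma tsum_lagSum_le (ϑ : ℕ → ℝ≥0∞) (n : ℕ) (P : Finset ℕ) :
    ∑' k, lagSum ϑ n P k ≤ P.card * ∑' m, ϑ m := by
  unfold lagSum
  rw [Summable.tsum_finsetSum fun _ _ => ENNReal.summable, ← nsmul_eq_mul]
  refine Finset.sum_le_card_nsmul _ _ _ fun a _ => ?_
  exact tsum_lagExt_comp_le ϑ (φ := fun k : ℕ => (a : ℤ) - n + k) fun a b h => by simpa using h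

lemma tsum_lagSum_mul_le (ϑ : ℕ → ℝ≥0∞) (n : ℕ) (P Q : Finset ℕ) :
    ∑' k, lagSum ϑ n P k * lagSum ϑ n Q k ≤ P.card * (∑' m, ϑ m) ^ 2 := by
  calc _ ≤ ∑' k, lagSum ϑ n P k * ∑' m, ϑ m :=
        ENNReal.tsum_le_tsum fun k => mul_le_mul_right (lagSum_le ϑ n Q k) _
    _ = (∑' k, lagSum ϑ n P k) * ∑' m, ϑ m := ENNReal.tsum_mul_right
    _ ≤ (P.card * ∑' m, ϑ m) * ∑' m, ϑ m := by gcongr; exact tsum_lagSum_le ϑ n P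
    _ = _ := by ring

lemma tsum_tail_le (ϑ : ℕ → ℝ≥0∞) :
    ∑' u, ∑' v, ϑ (u + v + 1) ≤ ∑' m : ℕ, m * ϑ m := by
  rw [← ENNReal.tsum_prod (f := fun u v => ϑ (u + v + 1)),
    ← Equiv.tsum_eq (Finset.HasAntidiagonal.sigmaAntidiagonalEquivProd (A := ℕ))
      (fun p : ℕ × ℕ => ϑ (p.1 + p.2 + 1)), ENNReal.tsum_sigma']
  have h : ∀ s : ℕ, ∑' p : Finset.HasAntidiagonal.antidiagonal s,
      ϑ ((Finset.HasAntidiagonal.sigmaAntidiagonalEquivProd ⟨s, p⟩).1 +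
        (Finset.HasAntidiagonal.sigmaAntidiagonalEquivProd ⟨s, p⟩).2 + 1) = (s + 1 : ℕ) * ϑ (s + 1) := fun s => by
    have : ∀ p : Finset.HasAntidiagonal.antidiagonal s, ϑ ((Finset.HasAntidiagonal.sigmaAntidiagonalEquivProd ⟨s, p⟩).1 +
        (Finset.HasAntidiagonal.sigmaAntidiagonalEquivProd ⟨s, p⟩).2 + 1) = ϑ (s + 1) := fun p => by
      have := Finset.HasAntidiagonal.mem_antidiagonal.1 p.2
      simp only [Finset.HasAntidiagonal.sigmaAntidiagonalEquivProd_apply, this]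
    simp only [this]
    rw [tsum_fintype, Finset.sum_const, Finset.card_univ, Fintype.card_coe,
      Finset.Nat.card_antidiagonal, nsmul_eq_mul]
  simp only [h]
  exact ENNReal.tsum_comp_le_tsum_of_injective (f := fun s : ℕ => s + 1) (add_left_injective 1)
    (fun m : ℕ => (m : ℝ≥0∞) * ϑ m)

/-- Sums over two groups of times separated by the time `c` share little influence, uniformly in the
sizes of the groups. -/
lemma tsum_lagSum_mul_le_of_separated (ϑ : ℕ → ℝ≥0∞) (n : ℕ) {P Q : Finset ℕ} {c : ℕ}
    (hP : ∀ a ∈ P, a < c) (hQ : ∀ b ∈ Q, c ≤ b) :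
    ∑' k, lagSum ϑ n P k * lagSum ϑ n Q k ≤ (∑' m, ϑ m) * ∑' m : ℕ, m * ϑ m := by
  set τ : ℕ → ℝ≥0∞ := fun u => ∑' v, ϑ (u + v + 1) with hτ
  have key : ∀ k : ℕ, lagSum ϑ n P k * lagSum ϑ n Q k ≤
      (∑' m, ϑ m) * lagExt τ ((c : ℤ) - 1 - n + k) := fun k => by
    by_cases hk : (c : ℤ) - 1 - n + k < 0
    · have : lagSum ϑ n P k = 0 := Finset.sum_eq_zero fun a ha => by
        have := hP a ha
        exact lagExt_of_neg ϑ (by omega)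
      rw [this, zero_mul]; exact zero_le
    · refine mul_le_mul' (lagSum_le ϑ n P k) ?_
      obtain ⟨u, hu⟩ := Int.eq_ofNat_of_zero_le (not_lt.1 hk)
      rw [hu, lagExt_natCast, hτ]
      have e : lagSum ϑ n Q k = ∑ b ∈ Q, ϑ (u + (b - c) + 1) :=
        Finset.sum_congr rfl fun b hb => by
          have := hQ b hb
          rw [← lagExt_natCast ϑ]
          congr 1
          push_cast [Nat.cast_sub this]
          linarith
      rw [e, ← Finset.sum_image (s := Q) (g := fun b => b - c) (f := fun v => ϑ (u + v + 1))]
      · exact ENNReal.sum_le_tsum _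
      · intro a ha b hb hab
        have h1 := hQ a ha
        have h2 := hQ b hb
        dsimp only at hab
        omega
  calc _ ≤ ∑' k : ℕ, (∑' m, ϑ m) * lagExt τ ((c : ℤ) - 1 - n + k) := ENNReal.tsum_le_tsum key
    _ = (∑' m, ϑ m) * ∑' k : ℕ, lagExt τ ((c : ℤ) - 1 - n + k) := ENNReal.tsum_mul_left
    _ ≤ _ := by
      refine mul_le_mul' le_rfl ?_
      exact (tsum_lagExt_comp_le τ (φ := fun k : ℕ => (c : ℤ) - 1 - n + k) fun a b h => by
        simpa using h).trans (tsum_tail_le ϑ)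

/-! ### Rows of weakly dependent variables and their block sums -/

section

/-- The number of blocks `{i, …, i + L - 1}`, `1 ≤ i ≤ N`, that contain the time `l`. -/
def blockCount (N L l : ℕ) : ℕ := ((Finset.Icc 1 N).filter fun i => i ≤ l ∧ l < i + L).card

lemma sum_blocks {M : Type*} [AddCommMonoid M] {N L n : ℕ} (hn : N + L = n + 1) (g : ℕ → M) :
    ∑ i ∈ Finset.Icc 1 N, ∑ l ∈ Finset.Ico i (i + L), g l =
      ∑ l ∈ Finset.Icc 1 n, blockCount N L l • g l := by
  rw [Finset.sum_comm' (t' := Finset.Icc 1 n)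
    (s' := fun l => (Finset.Icc 1 N).filter fun i => i ≤ l ∧ l < i + L)]
  · simp only [Finset.sum_const, blockCount]
  · intro i l
    simp only [Finset.mem_Icc, Finset.mem_Ico, Finset.mem_filter]
    omega

lemma blockCount_le (N L l : ℕ) : blockCount N L l ≤ min L N := by
  refine le_min ?_ ?_
  · calc blockCount N L l ≤ (Finset.Ico (l + 1 - L) (l + 1)).card := by
          refine Finset.card_le_card fun i hi => ?_
          simp only [Finset.mem_Icc, Finset.mem_Ico, Finset.mem_filter] at hi ⊢
          omega
      _ ≤ L := by simp only [Nat.card_Ico]; omega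
  · exact (Finset.card_filter_le _ _).trans (by simp)

lemma sum_blockCount {N L n : ℕ} (hn : N + L = n + 1) :
    ∑ l ∈ Finset.Icc 1 n, (blockCount N L l : ℝ) = L * N := by
  have h := sum_blocks hn (fun _ => (1 : ℝ))
  simp only [nsmul_eq_mul, mul_one, Finset.sum_const, Nat.card_Ico, Nat.add_sub_cancel_left,
    Nat.card_Icc] at h
  rw [← h]; push_cast [Nat.add_sub_cancel]; ring

/-- Averaging over blocks gives nearly equal weights to all times. -/
lemma sum_abs_weight_le {N L n : ℕ} (hL : 1 ≤ L) (hN : 1 ≤ N) (hn : N + L = n + 1) :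
    ∑ l ∈ Finset.Icc 1 n, |1 / (n : ℝ) - blockCount N L l / (L * N : ℝ)| ≤ 4 * (L / n : ℝ) := by
  have hL0 : (1 : ℝ) ≤ L := by exact_mod_cast hL
  have hN0 : (1 : ℝ) ≤ N := by exact_mod_cast hN
  have hnR : (N : ℝ) + L = n + 1 := by exact_mod_cast hn
  -- `c_l ≤ min L N` means that every weight `c_l / (L N)` is at most `1 / m`, and so is `1 / n`;
  -- the two nonnegative gaps have the same total, since both families of weights sum to one
  set m : ℝ := max (L : ℝ) N with hm
  have hmL : (L : ℝ) ≤ m := le_max_left _ _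
  have hmN : (N : ℝ) ≤ m := le_max_right _ _
  have hm0 : 0 < m := by linarith
  have hn0 : (0 : ℝ) < n := by linarith
  have hmn : m ≤ n := max_le (by linarith) (by linarith)
  have hprod : min (L : ℝ) N * m = L * N := min_mul_max _ _
  have hterm : ∀ l, |1 / (n : ℝ) - blockCount N L l / (L * N : ℝ)| ≤
      (1 / m - 1 / n) + (1 / m - blockCount N L l / (L * N : ℝ)) := fun l => by
    have h1 : 1 / (n : ℝ) ≤ 1 / m := one_div_le_one_div_of_le hm0 hmn
    have h2 : (blockCount N L l : ℝ) / (L * N : ℝ) ≤ 1 / m := by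
      have : (blockCount N L l : ℝ) ≤ min (L : ℝ) N := by exact_mod_cast blockCount_le N L l
      rw [div_le_div_iff₀ (by positivity) hm0, one_mul, ← hprod]
      gcongr
    rw [abs_le]; constructor <;> linarith
  calc _ ≤ ∑ l ∈ Finset.Icc 1 n, ((1 / m - 1 / n) + (1 / m - blockCount N L l / (L * N : ℝ))) :=
        Finset.sum_le_sum fun l _ => hterm l
    _ = 2 * (n - m) / m := by
      rw [Finset.sum_add_distrib, Finset.sum_sub_distrib, Finset.sum_sub_distrib,
        ← Finset.sum_div _ _ (L * N : ℝ), sum_blockCount hn]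
      simp only [Finset.sum_const, Nat.card_Icc, nsmul_eq_mul,
        Nat.add_sub_cancel]
      field_simp
      ring
    _ ≤ 4 * (L / n : ℝ) := by
      rw [← mul_div_assoc, div_le_div_iff₀ hm0 hn0]
      have h1 : (n : ℝ) - m ≤ L := by linarith
      have h2 : (n : ℝ) ≤ 2 * m := by linarith
      calc 2 * ((n : ℝ) - m) * n ≤ 2 * L * (2 * m) := by
            have : 0 ≤ (n : ℝ) - m := by linarith
            gcongr
        _ = _ := by ring

variable {Ω E : Type*} [m₀ : MeasurableSpace Ω] [mE : MeasurableSpace E]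

/-- A row of centered random variables with finite moment of order `p`, given by functions `F a`,
`1 ≤ a ≤ n`, of the innovations. The innovations are counted backwards from time `n`, so that the
innovation `k` has lag `a - n + k` from the time `a`; `ϑ` bounds the influences at each lag. -/
structure CenteredRow (μ : Measure Ω) (ε : ℕ → Ω → E) (ϑ : ℕ → ℝ≥0∞) (p : ℝ) (n : ℕ)
    (F : ℕ → (ℕ → E) → ℝ) : Prop where
  measurable : ∀ a ∈ Finset.Icc 1 n, Measurable (F a)
  memLp : ∀ a ∈ Finset.Icc 1 n, MemLp (F a ∘ innov ε) (ENNReal.ofReal p) μ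
  integral_eq_zero : ∀ a ∈ Finset.Icc 1 n, ∫ ω, F a (innov ε ω) ∂μ = 0
  influence_le : ∀ a ∈ Finset.Icc 1 n, ∀ k,
    influence μ ε (F a) k (ENNReal.ofReal p) ≤ lagExt ϑ ((a : ℤ) - n + k)

/-- The sum over the times in `P`. -/
def partSum (F : ℕ → (ℕ → E) → ℝ) (P : Finset ℕ) (y : ℕ → E) : ℝ := ∑ a ∈ P, F a y

/-- The sum over all blocks of the products of the block sums of two coordinates, without
normalization. -/
def blockProd (F F' : ℕ → (ℕ → E) → ℝ) (N L : ℕ) (y : ℕ → E) : ℝ :=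
  ∑ i ∈ Finset.Icc 1 N,
    partSum F (Finset.Ico i (i + L)) y * partSum F' (Finset.Ico i (i + L)) y

lemma block_subset {N L n i : ℕ} (hn : N + L = n + 1) (hi : i ∈ Finset.Icc 1 N) :
    Finset.Ico i (i + L) ⊆ Finset.Icc 1 n := fun l hl => by
  simp only [Finset.mem_Icc, Finset.mem_Ico] at *
  omega

namespace CenteredRow

variable {μ : Measure Ω} {ε : ℕ → Ω → E} {ϑ : ℕ → ℝ≥0∞} {p : ℝ} {n N L : ℕ}
  {F F' : ℕ → (ℕ → E) → ℝ} {P Q : Finset ℕ}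

lemma measurable_partSum (h : CenteredRow μ ε ϑ p n F) (hP : P ⊆ Finset.Icc 1 n) :
    Measurable (partSum F P) :=
  Finset.measurable_fun_sum _ fun a ha => h.measurable a (hP ha)

lemma memLp_partSum (h : CenteredRow μ ε ϑ p n F) (hP : P ⊆ Finset.Icc 1 n) :
    MemLp (partSum F P ∘ innov ε) (ENNReal.ofReal p) μ :=
  memLp_finsetSum P (f := fun a ω => F a (innov ε ω)) fun a ha => h.memLp a (hP ha)

lemma influence_partSum_le (h : CenteredRow μ ε ϑ p n F) (hε : ∀ k, Measurable (ε k)) (hp : 4 ≤ p)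
    (hP : P ⊆ Finset.Icc 1 n) (k : ℕ) :
    influence μ ε (partSum F P) k (ENNReal.ofReal p) ≤ lagSum ϑ n P k :=
  (influence_sum_le hε P (fun a ha => h.measurable a (hP ha)) k
    (by simpa using by linarith)).trans
    (Finset.sum_le_sum fun a ha => h.influence_le a (hP ha) k)

lemma holderTriple_half {p : ℝ} (hp : 4 ≤ p) :
    ENNReal.HolderTriple (ENNReal.ofReal p) (ENNReal.ofReal p) (ENNReal.ofReal (p / 2)) := by
  refine ⟨?_⟩
  have hp0 : 0 < p := by linarith
  rw [← ENNReal.ofReal_inv_of_pos hp0, ← ENNReal.ofReal_inv_of_pos (by positivity),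
    ← ENNReal.ofReal_add (by positivity) (by positivity)]
  congr 1
  field_simp
  norm_num

lemma measurable_blockProd (h : CenteredRow μ ε ϑ p n F) (h' : CenteredRow μ ε ϑ p n F')
    (hn : N + L = n + 1) : Measurable (blockProd F F' N L) :=
  Finset.measurable_fun_sum _ fun _ hi =>
    (h.measurable_partSum (block_subset hn hi)).mul (h'.measurable_partSum (block_subset hn hi))

lemma memLp_blockProd (h : CenteredRow μ ε ϑ p n F) (h' : CenteredRow μ ε ϑ p n F')
    (hp : 4 ≤ p) (hn : N + L = n + 1) :
    MemLp (blockProd F F' N L ∘ innov ε) (ENNReal.ofReal (p / 2)) μ := by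
  have := holderTriple_half hp
  exact memLp_finsetSum (Finset.Icc 1 N) (f := fun i ω =>
    partSum F (Finset.Ico i (i + L)) (innov ε ω) * partSum F' (Finset.Ico i (i + L)) (innov ε ω))
    fun i hi => (h'.memLp_partSum (block_subset hn hi)).smul (h.memLp_partSum (block_subset hn hi))

variable [IsProbabilityMeasure μ]

lemma memLp_two_partSum (h : CenteredRow μ ε ϑ p n F) (hp : 4 ≤ p) (hP : P ⊆ Finset.Icc 1 n) :
    MemLp (partSum F P ∘ innov ε) 2 μ :=
  (h.memLp_partSum hP).mono_exponent (by
    rw [← ENNReal.ofReal_ofNat]; exact ENNReal.ofReal_le_ofReal (by linarith))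

lemma integral_partSum (h : CenteredRow μ ε ϑ p n F) (hp : 4 ≤ p) (hP : P ⊆ Finset.Icc 1 n) :
    ∫ ω, partSum F P (innov ε ω) ∂μ = 0 := by
  unfold partSum
  rw [integral_finsetSum]
  · exact Finset.sum_eq_zero fun a ha => h.integral_eq_zero a (hP ha)
  · exact fun a ha => (h.memLp a (hP ha)).integrable (by simpa using by linarith)

lemma influence_two_partSum_le (h : CenteredRow μ ε ϑ p n F) (hε : ∀ k, Measurable (ε k))
    (hp : 4 ≤ p) (hP : P ⊆ Finset.Icc 1 n) (k : ℕ) :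
    influence μ ε (partSum F P) k 2 ≤ lagSum ϑ n P k := by
  refine le_trans ?_ (h.influence_partSum_le hε hp hP k)
  refine eLpNorm_le_eLpNorm_of_exponent_le (by
    rw [← ENNReal.ofReal_ofNat]; exact ENNReal.ofReal_le_ofReal (by linarith)) ?_
  exact (((h.measurable_partSum hP).comp ((measurable_innov hε).comp measurable_fst)).sub
    ((h.measurable_partSum hP).comp (measurable_resample hε k))).aestronglyMeasurable

/-- A sum over `P` has the size of a sum of `|P|` independent variables. -/
lemma eLpNorm_partSum_sq_le (h : CenteredRow μ ε ϑ p n F) (hε : ∀ k, Measurable (ε k))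
    (hind : iIndepFun ε μ) (hp : 4 ≤ p) (hP : P ⊆ Finset.Icc 1 n) :
    eLpNorm (partSum F P ∘ innov ε) (ENNReal.ofReal p) μ ^ 2 ≤
      martConst p * (P.card * (∑' m, ϑ m) ^ 2) := by
  have h1 := eLpNorm_sub_integral_sq_le hε hind (h.measurable_partSum hP) (by linarith)
    (h.memLp_partSum hP)
  rw [h.integral_partSum hp hP] at h1
  simp only [sub_zero] at h1
  refine h1.trans (mul_le_mul' le_rfl (le_trans ?_ (tsum_lagSum_mul_le ϑ n P P)))
  refine ENNReal.tsum_le_tsum fun k => ?_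
  rw [sq]
  exact mul_le_mul' (h.influence_partSum_le hε hp hP k) (h.influence_partSum_le hε hp hP k)

lemma enorm_covariance_partSum_le (h : CenteredRow μ ε ϑ p n F) (h' : CenteredRow μ ε ϑ p n F')
    (hε : ∀ k, Measurable (ε k)) (hind : iIndepFun ε μ) (hp : 4 ≤ p) (hϑ : ∑' m, ϑ m ≠ ∞)
    (hP : P ⊆ Finset.Icc 1 n) (hQ : Q ⊆ Finset.Icc 1 n) :
    ‖covariance (partSum F P ∘ innov ε) (partSum F' Q ∘ innov ε) μ‖ₑ ≤
      ∑' k, lagSum ϑ n P k * lagSum ϑ n Q k := by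
  refine (enorm_covariance_le hε hind (h.measurable_partSum hP) (h'.measurable_partSum hQ)
    (h.memLp_two_partSum hp hP) (h'.memLp_two_partSum hp hQ) ?_).trans
    (ENNReal.tsum_le_tsum fun k => mul_le_mul' (h.influence_two_partSum_le hε hp hP k)
      (h'.influence_two_partSum_le hε hp hQ k))
  refine ne_top_of_le_ne_top ?_ (le_trans (ENNReal.tsum_le_tsum fun k => ?_)
    (tsum_lagSum_mul_le ϑ n P P))
  · exact ENNReal.mul_ne_top (ENNReal.natCast_ne_top _) (ENNReal.pow_ne_top hϑ)
  · rw [sq]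
    exact mul_le_mul' (h.influence_two_partSum_le hε hp hP k)
      (h.influence_two_partSum_le hε hp hP k)

lemma abs_covariance_partSum_le (h : CenteredRow μ ε ϑ p n F) (h' : CenteredRow μ ε ϑ p n F')
    (hε : ∀ k, Measurable (ε k)) (hind : iIndepFun ε μ) (hp : 4 ≤ p) (hϑ : ∑' m, ϑ m ≠ ∞)
    (hP : P ⊆ Finset.Icc 1 n) (hQ : Q ⊆ Finset.Icc 1 n) :
    |covariance (partSum F P ∘ innov ε) (partSum F' Q ∘ innov ε) μ| ≤
      P.card * (∑' m, ϑ m).toReal ^ 2 := by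
  have h1 := (h.enorm_covariance_partSum_le h' hε hind hp hϑ hP hQ).trans
    (tsum_lagSum_mul_le ϑ n P Q)
  have h2 := ENNReal.toReal_mono
    (ENNReal.mul_ne_top (ENNReal.natCast_ne_top _) (ENNReal.pow_ne_top hϑ)) h1
  simpa using h2

lemma abs_covariance_partSum_le_of_separated (h : CenteredRow μ ε ϑ p n F)
    (h' : CenteredRow μ ε ϑ p n F')
    (hε : ∀ k, Measurable (ε k)) (hind : iIndepFun ε μ) (hp : 4 ≤ p) (hϑ : ∑' m, ϑ m ≠ ∞)
    (hϑ' : ∑' m : ℕ, m * ϑ m ≠ ∞)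
    (hP : P ⊆ Finset.Icc 1 n) (hQ : Q ⊆ Finset.Icc 1 n) {c : ℕ} (hPc : ∀ a ∈ P, a < c)
    (hQc : ∀ b ∈ Q, c ≤ b) :
    |covariance (partSum F P ∘ innov ε) (partSum F' Q ∘ innov ε) μ| ≤
      (∑' m, ϑ m).toReal * (∑' m : ℕ, m * ϑ m).toReal := by
  have h1 := (h.enorm_covariance_partSum_le h' hε hind hp hϑ hP hQ).trans
    (tsum_lagSum_mul_le_of_separated ϑ n hPc hQc)
  have h2 := ENNReal.toReal_mono (ENNReal.mul_ne_top hϑ hϑ') h1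
  simpa using h2

/-- Fluctuation of the sum of the products of block sums in the norm of order `p / 2`. -/
theorem eLpNorm_blockProd_sub_sq_le (h : CenteredRow μ ε ϑ p n F) (h' : CenteredRow μ ε ϑ p n F')
    (hε : ∀ k, Measurable (ε k)) (hind : iIndepFun ε μ) (hp : 4 ≤ p) (hn : N + L = n + 1) :
    eLpNorm (fun ω => blockProd F F' N L (innov ε ω) - ∫ ω', blockProd F F' N L (innov ε ω') ∂μ)
      (ENNReal.ofReal (p / 2)) μ ^ 2 ≤
      martConst (p / 2) * (4 * (martConst p * (L * (∑' m, ϑ m) ^ 2)) * (min L N : ℕ) ^ 2 *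
        (n * (∑' m, ϑ m) ^ 2)) := by
  have := holderTriple_half hp
  -- `b` bounds the norms of the block sums
  set b : ℝ≥0∞ := (martConst p * (L * (∑' m, ϑ m) ^ 2)) ^ (1 / 2 : ℝ) with hb
  have hb2 : b ^ 2 = martConst p * (L * (∑' m, ϑ m) ^ 2) := by
    rw [hb, ← ENNReal.rpow_natCast, ← ENNReal.rpow_mul]; norm_num
  have hU : ∀ {F : ℕ → (ℕ → E) → ℝ}, CenteredRow μ ε ϑ p n F → ∀ i ∈ Finset.Icc 1 N,
      eLpNorm (partSum F (Finset.Ico i (i + L)) ∘ innov ε) (ENNReal.ofReal p) μ ≤ b := by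
    intro F h i hi
    have h1 := h.eLpNorm_partSum_sq_le hε hind hp (block_subset hn hi)
    rw [Nat.card_Ico, Nat.add_sub_cancel_left] at h1
    rw [hb, one_div, ENNReal.le_rpow_inv_iff (by norm_num)]
    refine le_trans (le_of_eq ?_) h1
    norm_num
  have hinfl : ∀ k, influence μ ε (blockProd F F' N L) k (ENNReal.ofReal (p / 2)) ≤
      2 * b * (min L N : ℕ) * lagSum ϑ n (Finset.Icc 1 n) k := fun k => by
    have hq : 1 ≤ ENNReal.ofReal (p / 2) := by simpa using by linarith
    calc influence μ ε (blockProd F F' N L) k (ENNReal.ofReal (p / 2))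
        ≤ ∑ i ∈ Finset.Icc 1 N, influence μ ε (fun y => partSum F (Finset.Ico i (i + L)) y *
            partSum F' (Finset.Ico i (i + L)) y) k (ENNReal.ofReal (p / 2)) :=
          influence_sum_le hε _ (fun i hi => (h.measurable_partSum (block_subset hn hi)).mul
            (h'.measurable_partSum (block_subset hn hi))) k hq
      _ ≤ ∑ i ∈ Finset.Icc 1 N, 2 * b * lagSum ϑ n (Finset.Ico i (i + L)) k := by
          refine Finset.sum_le_sum fun i hi => ?_
          have hs := block_subset hn hi
          refine (influence_mul_le hε hind (h.measurable_partSum hs) (h'.measurable_partSum hs) k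
            (p := ENNReal.ofReal p) hq).trans ?_
          calc _ ≤ b * lagSum ϑ n (Finset.Ico i (i + L)) k +
                lagSum ϑ n (Finset.Ico i (i + L)) k * b :=
                add_le_add (mul_le_mul' (hU h i hi) (h'.influence_partSum_le hε hp hs k))
                  (mul_le_mul' (h.influence_partSum_le hε hp hs k) (hU h' i hi))
            _ = _ := by ring
      _ = 2 * b * ∑ l ∈ Finset.Icc 1 n, blockCount N L l • lagExt ϑ ((l : ℤ) - n + k) := by
          rw [← Finset.mul_sum]
          unfold lagSum
          rw [sum_blocks hn]
      _ ≤ 2 * b * ∑ l ∈ Finset.Icc 1 n, ((min L N : ℕ) : ℝ≥0∞) * lagExt ϑ ((l : ℤ) - n + k) := by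
          gcongr with l hl
          rw [nsmul_eq_mul]
          gcongr
          exact blockCount_le N L l
      _ = _ := by rw [← Finset.mul_sum, lagSum]; ring
  refine (eLpNorm_sub_integral_sq_le hε hind (h.measurable_blockProd h' hn) (by linarith)
    (h.memLp_blockProd h' hp hn)).trans (mul_le_mul' le_rfl ?_)
  calc _ ≤ ∑' k, (2 * b * (min L N : ℕ)) ^ 2 *
        (lagSum ϑ n (Finset.Icc 1 n) k * lagSum ϑ n (Finset.Icc 1 n) k) := by
        refine ENNReal.tsum_le_tsum fun k => ?_
        calc _ ≤ (2 * b * (min L N : ℕ) * lagSum ϑ n (Finset.Icc 1 n) k) ^ 2 := by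
              gcongr; exact hinfl k
          _ = _ := by ring
    _ ≤ (2 * b * (min L N : ℕ)) ^ 2 * ((Finset.Icc 1 n).card * (∑' m, ϑ m) ^ 2) := by
        rw [ENNReal.tsum_mul_left]
        exact mul_le_mul' le_rfl (tsum_lagSum_mul_le ϑ n _ _)
    _ = _ := by rw [mul_pow, mul_pow, hb2, Nat.card_Icc, Nat.add_sub_cancel]; norm_num

/-- The mean of the normalized sum of the products of block sums is close to the covariance of the
normalized full sums. -/
theorem abs_covariance_sub_integral_blockProd_le (h : CenteredRow μ ε ϑ p n F)
    (h' : CenteredRow μ ε ϑ p n F') (hε : ∀ k, Measurable (ε k)) (hind : iIndepFun ε μ)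
    (hp : 4 ≤ p) (hϑ : ∑' m, ϑ m ≠ ∞) (hϑ' : ∑' m : ℕ, m * ϑ m ≠ ∞)
    (hL : 1 ≤ L) (hN : 1 ≤ N) (hn : N + L = n + 1) :
    |covariance (partSum F (Finset.Icc 1 n) ∘ innov ε) (partSum F' (Finset.Icc 1 n) ∘ innov ε) μ / n
      - (∫ ω, blockProd F F' N L (innov ε ω) ∂μ) / (L * N)| ≤
      4 * (∑' m, ϑ m).toReal ^ 2 * (L / n) +
        2 * ((∑' m, ϑ m).toReal * (∑' m : ℕ, m * ϑ m).toReal) * (1 / L) := by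
  set τ := (∑' m, ϑ m).toReal with hτ
  set τ₁ := (∑' m : ℕ, m * ϑ m).toReal with hτ₁
  have hL0 : (1 : ℝ) ≤ L := by exact_mod_cast hL
  have hN0 : (1 : ℝ) ≤ N := by exact_mod_cast hN
  set X' := partSum F' (Finset.Icc 1 n) ∘ innov ε with hX'
  -- `s l` is the contribution of the time `l` to the covariance of the full sums
  set s : ℕ → ℝ := fun l => covariance (F l ∘ innov ε) X' μ with hs
  have hX'2 : MemLp X' 2 μ := h'.memLp_two_partSum hp subset_rfl
  have hF2 : ∀ l ∈ Finset.Icc 1 n, MemLp (F l ∘ innov ε) 2 μ := fun l hl =>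
    (h.memLp l hl).mono_exponent (by
      rw [← ENNReal.ofReal_ofNat]; exact ENNReal.ofReal_le_ofReal (by linarith))
  have hsum : ∀ P ⊆ Finset.Icc 1 n,
      covariance (partSum F P ∘ innov ε) X' μ = ∑ l ∈ P, s l := fun P hP =>
    covariance_fun_sum_left' (X := fun l ω => F l (innov ε ω)) (fun l hl => hF2 l (hP hl)) hX'2
  have hs_le : ∀ l ∈ Finset.Icc 1 n, |s l| ≤ τ ^ 2 := fun l hl => by
    have h1 := h.abs_covariance_partSum_le h' hε hind hp hϑ (P := {l}) (by simpa using hl) subset_rfl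
    have h2 := hsum {l} (by simpa using hl)
    rw [← hX', h2, Finset.sum_singleton] at h1
    simpa using h1
  -- the covariance of a block sum with the full sum splits into the part inside the block and two
  -- parts separated from the block
  have hblock : ∀ i ∈ Finset.Icc 1 N,
      |∑ l ∈ Finset.Ico i (i + L), s l - ∫ ω, partSum F (Finset.Ico i (i + L)) (innov ε ω) *
        partSum F' (Finset.Ico i (i + L)) (innov ε ω) ∂μ| ≤ 2 * (τ * τ₁) := fun i hi => by
    have hB := block_subset hn hi
    have hi' := Finset.mem_Icc.1 hi
    have hA : Finset.Ico 1 i ⊆ Finset.Icc 1 n := fun l hl => by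
      simp only [Finset.mem_Icc, Finset.mem_Ico] at *; omega
    have hC : Finset.Ico (i + L) (n + 1) ⊆ Finset.Icc 1 n := fun l hl => by
      simp only [Finset.mem_Icc, Finset.mem_Ico] at *; omega
    have e1 : X' = (partSum F' (Finset.Ico 1 i) ∘ innov ε +
        partSum F' (Finset.Ico i (i + L)) ∘ innov ε) +
        partSum F' (Finset.Ico (i + L) (n + 1)) ∘ innov ε := by
      funext ω
      simp only [hX', partSum, Pi.add_apply, Function.comp_apply]
      rw [Finset.sum_Ico_consecutive _ (by omega) (by omega),
        Finset.sum_Ico_consecutive _ (by omega) (by omega)]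
      rfl
    have mA := h'.memLp_two_partSum hp hA
    have mB := h'.memLp_two_partSum hp hB
    have mC := h'.memLp_two_partSum hp hC
    have mU := h.memLp_two_partSum hp hB
    have e2 : ∫ ω, partSum F (Finset.Ico i (i + L)) (innov ε ω) *
        partSum F' (Finset.Ico i (i + L)) (innov ε ω) ∂μ =
        covariance (partSum F (Finset.Ico i (i + L)) ∘ innov ε)
          (partSum F' (Finset.Ico i (i + L)) ∘ innov ε) μ := by
      rw [covariance_eq_sub mU mB]
      have z : ∫ ω, (partSum F (Finset.Ico i (i + L)) ∘ innov ε) ω ∂μ = 0 :=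
        h.integral_partSum hp hB
      rw [z, zero_mul, sub_zero]
      rfl
    have c1 : |covariance (partSum F (Finset.Ico i (i + L)) ∘ innov ε)
        (partSum F' (Finset.Ico 1 i) ∘ innov ε) μ| ≤ τ * τ₁ := by
      rw [covariance_comm]
      exact h'.abs_covariance_partSum_le_of_separated h hε hind hp hϑ hϑ' hA hB
        (c := i) (fun a ha => (Finset.mem_Ico.1 ha).2) (fun a ha => (Finset.mem_Ico.1 ha).1)
    have c2 : |covariance (partSum F (Finset.Ico i (i + L)) ∘ innov ε)
        (partSum F' (Finset.Ico (i + L) (n + 1)) ∘ innov ε) μ| ≤ τ * τ₁ :=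
      h.abs_covariance_partSum_le_of_separated h' hε hind hp hϑ hϑ' hB hC
        (c := i + L) (fun a ha => (Finset.mem_Ico.1 ha).2) (fun a ha => (Finset.mem_Ico.1 ha).1)
    rw [← hsum _ hB, e2, e1, covariance_add_right mU (mA.add mB) mC, covariance_add_right mU mA mB]
    rw [abs_le] at *
    constructor <;> linarith [c1.1, c1.2, c2.1, c2.2]
  have hW : ∫ ω, blockProd F F' N L (innov ε ω) ∂μ = ∑ i ∈ Finset.Icc 1 N,
      ∫ ω, partSum F (Finset.Ico i (i + L)) (innov ε ω) *
        partSum F' (Finset.Ico i (i + L)) (innov ε ω) ∂μ :=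
    integral_finsetSum _ fun i hi => (h.memLp_two_partSum hp (block_subset hn hi)).integrable_mul
      (h'.memLp_two_partSum hp (block_subset hn hi))
  have hdouble := sum_blocks hn s
  have e : covariance (partSum F (Finset.Icc 1 n) ∘ innov ε) X' μ / n
      - (∫ ω, blockProd F F' N L (innov ε ω) ∂μ) / (L * N) =
      ∑ l ∈ Finset.Icc 1 n, (1 / (n : ℝ) - blockCount N L l / (L * N : ℝ)) * s l +
      (∑ i ∈ Finset.Icc 1 N, (∑ l ∈ Finset.Ico i (i + L), s l -
        ∫ ω, partSum F (Finset.Ico i (i + L)) (innov ε ω) *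
          partSum F' (Finset.Ico i (i + L)) (innov ε ω) ∂μ)) / (L * N) := by
    rw [Finset.sum_sub_distrib, hdouble, ← hW, hsum _ subset_rfl]
    simp only [sub_mul, Finset.sum_sub_distrib, nsmul_eq_mul, sub_div, Finset.sum_div]
    have e1 : ∀ l, 1 / (n : ℝ) * s l = s l / n := fun l => by ring
    have e2 : ∀ l, (blockCount N L l : ℝ) / (L * N) * s l = blockCount N L l * s l / (L * N) :=
      fun l => by ring
    simp only [e1, e2]
    ring
  rw [e]
  refine (abs_add_le _ _).trans (add_le_add ?_ ?_)
  · calc _ ≤ ∑ l ∈ Finset.Icc 1 n, |1 / (n : ℝ) - blockCount N L l / (L * N : ℝ)| * τ ^ 2 := by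
          refine (Finset.abs_sum_le_sum_abs _ _).trans (Finset.sum_le_sum fun l hl => ?_)
          rw [abs_mul]
          gcongr
          exact hs_le l hl
      _ ≤ 4 * (L / n : ℝ) * τ ^ 2 := by
          rw [← Finset.sum_mul]
          gcongr
          exact sum_abs_weight_le hL hN hn
      _ = _ := by ring
  · rw [abs_div, abs_of_nonneg (by positivity : (0 : ℝ) ≤ L * N)]
    calc _ ≤ (N * (2 * (τ * τ₁))) / (L * N : ℝ) := by
          gcongr
          refine (Finset.abs_sum_le_sum_abs _ _).trans ?_
          refine (Finset.sum_le_card_nsmul _ _ _ hblock).trans (le_of_eq ?_)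
          rw [Nat.card_Icc, Nat.add_sub_cancel, nsmul_eq_mul]
      _ = _ := by field_simp

end CenteredRow

end

/-! ### Conditional covariance of the multiplier statistic -/

section

variable {Ω : Type*} [m₀ : MeasurableSpace Ω] {μ : Measure Ω} [IsProbabilityMeasure μ]

/-- A factor independent of the conditioning sigma-algebra is averaged out of a product whose other
factor is measurable. -/
lemma condExp_mul_of_indep {m : MeasurableSpace Ω} (hm : m ≤ m₀) {Y Z : Ω → ℝ}
    (hYm : Measurable[m₀] Y) (hY : Integrable Y μ) (hZm : Measurable[m] Z) (hZ : Integrable Z μ)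
    (hind : Indep (MeasurableSpace.comap Y inferInstance) m μ) :
    Integrable (fun ω => Y ω * Z ω) μ ∧
      μ[fun ω => Y ω * Z ω | m] =ᵐ[μ] fun ω => (∫ ω', Y ω' ∂μ) * Z ω := by
  have hYZ : IndepFun Y Z μ :=
    (IndepFun_iff_Indep _ _ _).2 (indep_of_indep_of_le_right hind hZm.comap_le)
  have hint : Integrable (fun ω => Y ω * Z ω) μ := hYZ.integrable_mul hY hZ
  refine ⟨hint, ?_⟩
  have h1 := condExp_mul_of_stronglyMeasurable_right (m := m) (f := Y) hZm.stronglyMeasurable hint hY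
  have h2 := condExp_indep_eq (μ := μ) (f := Y) hYm.comap_le hm
    (comap_measurable Y).stronglyMeasurable hind
  filter_upwards [h1, h2] with ω e1 e2
  rw [Pi.mul_apply, e2] at e1
  exact e1

lemma integral_normal_multipliers {B : ℕ → Ω → ℝ} (hB_meas : ∀ i, Measurable (B i))
    (hB_law : ∀ i, Measure.map (B i) μ = gaussianReal 0 1) (hB_indep : iIndepFun B μ) :
    (∀ i, MemLp (B i) 2 μ) ∧ (∀ i, ∫ ω, B i ω ∂μ = 0) ∧
      ∀ i i', ∫ ω, B i ω * B i' ω ∂μ = if i = i' then 1 else 0 := by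
  have h2 : ∀ i, MemLp (B i) 2 μ := fun i => by
    have h : MemLp id 2 (gaussianReal 0 1) := memLp_id_gaussianReal 2
    rw [← hB_law i] at h
    exact (memLp_map_measure_iff aestronglyMeasurable_id (hB_meas i).aemeasurable).1 h
  have h0 : ∀ i, ∫ ω, B i ω ∂μ = 0 := fun i => by
    have h := integral_map (μ := μ) (hB_meas i).aemeasurable (f := id) aestronglyMeasurable_id
    rw [hB_law i] at h
    simpa using h.symm
  refine ⟨h2, h0, fun i i' => ?_⟩
  by_cases hi : i = i'
  · subst hi
    have h := variance_eq_sub (h2 i)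
    have hv : variance (B i) μ = 1 := by
      have := variance_map (μ := μ) (Y := B i) (X := id) aemeasurable_id (hB_meas i).aemeasurable
      rw [hB_law i, variance_id_gaussianReal] at this
      simpa using this.symm
    rw [hv, h0 i] at h
    simp only [if_true]
    rw [zero_pow two_ne_zero, sub_zero] at h
    rw [h]
    congr 1; funext ω; simp [sq]
  · rw [if_neg hi]
    have := (hB_indep.indepFun hi).integral_fun_mul_eq_mul_integral
      (hB_meas i).aestronglyMeasurable (hB_meas i').aestronglyMeasurable
    rw [this, h0 i, zero_mul]

/-- Given the data, the covariance matrix of the multiplier statistic is the average of the products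
of the block sums. -/
theorem condCovMat_normBootStat {d n L : ℕ} (hL1 : 1 ≤ L) (hLn : L ≤ n)
    {x : ℕ → Ω → Fin d → ℝ} (hxm : ∀ i ∈ Finset.Icc 1 n, Measurable (x i))
    (hx2 : ∀ i ∈ Finset.Icc 1 n, ∀ j, MemLp (fun ω => x i ω j) 2 μ)
    {B : ℕ → Ω → ℝ} (hB_meas : ∀ i, Measurable (B i))
    (hB_law : ∀ i, Measure.map (B i) μ = gaussianReal 0 1) (hB_indep : iIndepFun B μ)
    (hB_data : IndepFun (fun ω i => B i ω) (sample n x) μ) (j k : Fin d) :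
    ∀ᵐ ω ∂μ, condCovMat μ (sampleSigma n x) (normBootStat n L x B) ω j k =
      (∑ i ∈ Finset.Icc 1 (n - L + 1), (∑ l ∈ Finset.Ico i (i + L), x l ω j) *
        ∑ l ∈ Finset.Ico i (i + L), x l ω k) / (L * (n - L + 1 : ℕ)) := by
  obtain ⟨hB2, hB0, hBB⟩ := integral_normal_multipliers hB_meas hB_law hB_indep
  have hsm : Measurable (sample n x) := measurable_pi_lambda _ fun i => hxm i i.2
  have hm : sampleSigma n x ≤ m₀ := hsm.comap_le
  have hind : Indep (MeasurableSpace.comap (fun ω i => B i ω) inferInstance) (sampleSigma n x) μ :=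
    (IndepFun_iff_Indep _ _ _).1 hB_data
  set c : ℝ := √((n : ℝ) - (L : ℝ) + 1) with hc
  set φ : ℕ → Fin d → Ω → ℝ := fun i j ω => blockSum L x i ω j / c with hφ
  have hsub : ∀ i ∈ Finset.Icc 1 (n - L + 1), ∀ l ∈ Finset.Ico i (i + L), l ∈ Finset.Icc 1 n :=
    fun i hi l hl => by
      simp only [Finset.mem_Icc, Finset.mem_Ico] at *; omega
  have hφm : ∀ i ∈ Finset.Icc 1 (n - L + 1), ∀ j, Measurable[sampleSigma n x] (φ i j) := by
    intro i hi j
    have h1 : ∀ l ∈ Finset.Ico i (i + L), Measurable[sampleSigma n x] fun ω => x l ω j :=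
      fun l hl => by
        have h2 : Measurable fun y : Finset.Icc 1 n → Fin d → ℝ => y ⟨l, hsub i hi l hl⟩ j :=
          (measurable_pi_apply j).comp (measurable_pi_apply _)
        exact h2.comp (comap_measurable (sample n x))
    exact ((Finset.measurable_fun_sum _ h1).div_const _).div_const _
  have hφ2 : ∀ i ∈ Finset.Icc 1 (n - L + 1), ∀ j, MemLp (φ i j) 2 μ := fun i hi j => by
    have h1 := memLp_finsetSum (Finset.Ico i (i + L)) (f := fun l ω => x l ω j) (p := 2) (μ := μ)
      fun l hl => hx2 l (hsub i hi l hl) j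
    have h2 := (h1.mul_const (√(L : ℝ))⁻¹).mul_const c⁻¹
    simpa only [hφ, blockSum, div_eq_mul_inv] using h2
  have hτ : ∀ j, (fun ω => normBootStat n L x B ω j) =
      ∑ i ∈ Finset.Icc 1 (n - L + 1), fun ω => B i ω * φ i j ω := fun j => by
    funext ω
    rw [Finset.sum_apply]
    simp only [normBootStat, bootStat, Finset.sum_div, hφ, mul_div_assoc]
    rfl
  have hone : ∀ i, ∀ hi : i ∈ Finset.Icc 1 (n - L + 1), ∀ j,
      Integrable (fun ω => B i ω * φ i j ω) μ ∧
      μ[fun ω => B i ω * φ i j ω | sampleSigma n x] =ᵐ[μ] fun ω => (∫ ω', B i ω' ∂μ) * φ i j ω :=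
    fun i hi j => condExp_mul_of_indep hm (hB_meas i) ((hB2 i).integrable (by norm_num))
      (hφm i hi j) ((hφ2 i hi j).integrable (by norm_num))
      (indep_of_indep_of_le_left hind
        ((measurable_pi_apply i).comp (comap_measurable fun ω i => B i ω)).comap_le)
  have hmean : ∀ j, μ[fun ω => normBootStat n L x B ω j | sampleSigma n x] =ᵐ[μ] 0 := fun j => by
    rw [hτ j]
    have h1 := condExp_finsetSum (μ := μ) (f := fun i ω => B i ω * φ i j ω)
      (s := Finset.Icc 1 (n - L + 1)) (fun i hi => (hone i hi j).1) (sampleSigma n x)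
    have h2 : ∀ᵐ ω ∂μ, ∀ i ∈ Finset.Icc 1 (n - L + 1),
        (μ[fun ω => B i ω * φ i j ω | sampleSigma n x]) ω = (∫ ω', B i ω' ∂μ) * φ i j ω :=
      (Finset.eventually_all _).2 fun i hi => (hone i hi j).2
    filter_upwards [h1, h2] with ω e1 e2
    rw [e1, Finset.sum_apply, Pi.zero_apply]
    exact Finset.sum_eq_zero fun i hi => by rw [e2 i hi, hB0, zero_mul]
  have htwo : ∀ q ∈ Finset.Icc 1 (n - L + 1) ×ˢ Finset.Icc 1 (n - L + 1),
      Integrable (fun ω => (B q.1 ω * B q.2 ω) * (φ q.1 j ω * φ q.2 k ω)) μ ∧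
      μ[fun ω => (B q.1 ω * B q.2 ω) * (φ q.1 j ω * φ q.2 k ω) | sampleSigma n x] =ᵐ[μ]
        fun ω => (∫ ω', B q.1 ω' * B q.2 ω' ∂μ) * (φ q.1 j ω * φ q.2 k ω) := by
    intro q hq
    obtain ⟨h1, h2⟩ := Finset.mem_product.1 hq
    refine condExp_mul_of_indep hm ((hB_meas _).mul (hB_meas _)) ((hB2 _).integrable_mul (hB2 _))
      ((hφm _ h1 j).mul (hφm _ h2 k)) ((hφ2 _ h1 j).integrable_mul (hφ2 _ h2 k))
      (indep_of_indep_of_le_left hind ?_)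
    have := comap_measurable (m := MeasurableSpace.pi) (fun ω (i : ℕ) => B i ω)
    exact (((measurable_pi_apply q.1).comp this).mul ((measurable_pi_apply q.2).comp this)).comap_le
  have hprod : (fun ω' =>
      (normBootStat n L x B ω' j -
        (μ[fun ω'' => normBootStat n L x B ω'' j | sampleSigma n x]) ω') *
      (normBootStat n L x B ω' k -
        (μ[fun ω'' => normBootStat n L x B ω'' k | sampleSigma n x]) ω')) =ᵐ[μ]
      ∑ q ∈ Finset.Icc 1 (n - L + 1) ×ˢ Finset.Icc 1 (n - L + 1),
        fun ω => (B q.1 ω * B q.2 ω) * (φ q.1 j ω * φ q.2 k ω) := by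
    filter_upwards [hmean j, hmean k] with ω e1 e2
    have t1 := congrFun (hτ j) ω
    have t2 := congrFun (hτ k) ω
    rw [e1, e2, Pi.zero_apply, sub_zero, sub_zero, t1, t2, Finset.sum_apply, Finset.sum_apply,
      Finset.sum_apply, Finset.sum_mul_sum, Finset.sum_product]
    exact Finset.sum_congr rfl fun i _ => Finset.sum_congr rfl fun i' _ => by ring
  have hce := condExp_congr_ae (m := sampleSigma n x) hprod
  have h1 := condExp_finsetSum (μ := μ)
    (f := fun (q : ℕ × ℕ) ω => (B q.1 ω * B q.2 ω) * (φ q.1 j ω * φ q.2 k ω))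
    (s := Finset.Icc 1 (n - L + 1) ×ˢ Finset.Icc 1 (n - L + 1)) (fun q hq => (htwo q hq).1)
    (sampleSigma n x)
  have h2 : ∀ᵐ ω ∂μ, ∀ q ∈ Finset.Icc 1 (n - L + 1) ×ˢ Finset.Icc 1 (n - L + 1),
      (μ[fun ω => (B q.1 ω * B q.2 ω) * (φ q.1 j ω * φ q.2 k ω) | sampleSigma n x]) ω =
        (∫ ω', B q.1 ω' * B q.2 ω' ∂μ) * (φ q.1 j ω * φ q.2 k ω) :=
    (Finset.eventually_all _).2 fun q hq => (htwo q hq).2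
  filter_upwards [hce, h1, h2] with ω e1 e2 e3
  change (μ[_ | sampleSigma n x]) ω = _
  rw [e1, e2, Finset.sum_apply, Finset.sum_congr rfl e3, Finset.sum_product, Finset.sum_div]
  have hLn' : (L : ℝ) ≤ n := by exact_mod_cast hLn
  have hLpos : (0 : ℝ) < L := by exact_mod_cast hL1
  have hcast : ((n - L + 1 : ℕ) : ℝ) = n - L + 1 := by push_cast [Nat.cast_sub hLn]; ring
  have hcc : c * c = (n - L + 1 : ℕ) := by
    rw [hcast]; exact Real.mul_self_sqrt (by linarith)
  have hLL : √(L : ℝ) * √(L : ℝ) = L := Real.mul_self_sqrt hLpos.le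
  refine Finset.sum_congr rfl fun i hi => ?_
  rw [Finset.sum_eq_single i]
  · rw [hBB, if_pos rfl, one_mul, ← hcc, ← hLL]
    simp only [hφ, blockSum]
    rw [div_div, div_div, div_mul_div_comm]
    congr 1; ring
  · intro i' _ hne
    rw [hBB, if_neg hne.symm, zero_mul]
  · exact fun h => absurd hi h

end

/-! ### Tail bounds for matrix norms -/

section

variable {Ω : Type*} [MeasurableSpace Ω] {μ : Measure Ω}

/-- A union bound over the entries: if every entry of a random matrix is a constant of size at most
`C β` plus a variable of `L^q` norm at most `C s`, then the entrywise maximum norm exceeds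
`M (s D + β)` with probability at most `(C / M) ^ q`, where `D ^ q` is the number of entries. -/
lemma measure_maxNorm_gt_le {d : ℕ} {A : Ω → Matrix (Fin d) (Fin d) ℝ} {q C s β D M : ℝ}
    (hq : 0 < q) (hC : 0 < C) (hs : 0 < s) (hβ : 0 ≤ β) (hD : 0 ≤ D) (hDq : D ^ q = (d : ℝ) ^ 2)
    (hM : C ≤ M)
    (hA : ∀ j k, ∃ (b : ℝ) (V : Ω → ℝ), Measurable V ∧ (∀ᵐ ω ∂μ, A ω j k = b + V ω) ∧
      |b| ≤ C * β ∧ eLpNorm V (ENNReal.ofReal q) μ ≤ ENNReal.ofReal (C * s)) :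
    μ {ω | M * (s * D + β) < |maxNorm (A ω)|} ≤ ENNReal.ofReal ((C / M) ^ q) := by
  have hM0 : 0 < M := hC.trans_le hM
  have hpos : 0 ≤ M * (s * D + β) := by positivity
  have hsub : {ω | M * (s * D + β) < |maxNorm (A ω)|} ⊆
      ⋃ jk : Fin d × Fin d, {ω | M * (s * D + β) < |A ω jk.1 jk.2|} := fun ω hω => by
    have h0 : 0 ≤ maxNorm (A ω) := Real.iSup_nonneg fun _ => abs_nonneg _
    have h1 : M * (s * D + β) < ⨆ jk : Fin d × Fin d, |A ω jk.1 jk.2| := by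
      have : M * (s * D + β) < |maxNorm (A ω)| := hω
      rwa [abs_of_nonneg h0] at this
    rcases isEmpty_or_nonempty (Fin d × Fin d) with he | he
    · rw [Real.iSup_of_isEmpty] at h1
      exact absurd h1 (not_lt.2 hpos)
    · obtain ⟨jk, hjk⟩ := exists_lt_of_lt_ciSup h1
      exact Set.mem_iUnion.2 ⟨jk, hjk⟩
  have hentry : ∀ jk : Fin d × Fin d, μ {ω | M * (s * D + β) < |A ω jk.1 jk.2|} ≤
      ENNReal.ofReal ((C / M) ^ q / (d : ℝ) ^ 2) := fun jk => by
    obtain ⟨b, V, hVm, hAV, hb, hV⟩ := hA jk.1 jk.2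
    have hd0 : 0 < d := jk.1.pos
    have hD0 : 0 < D := hD.lt_of_ne fun h => by
      rw [← h, Real.zero_rpow hq.ne'] at hDq
      have : (0 : ℝ) < (d : ℝ) ^ 2 := by positivity
      linarith
    have ht : 0 < M * s * D := by positivity
    have h1 : μ {ω | M * (s * D + β) < |A ω jk.1 jk.2|} ≤
        μ {ω | ENNReal.ofReal (M * s * D) ≤ ‖V ω‖ₑ} := by
      refine measure_mono_ae ?_
      filter_upwards [hAV] with ω hω hlt
      change ENNReal.ofReal (M * s * D) ≤ ‖V ω‖ₑ
      rw [← ofReal_norm]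
      refine ENNReal.ofReal_le_ofReal ?_
      have h2 : M * (s * D + β) < |A ω jk.1 jk.2| := hlt
      have h3 : |A ω jk.1 jk.2| ≤ |b| + |V ω| := hω ▸ abs_add_le _ _
      have h4 : C * β ≤ M * β := by gcongr
      rw [Real.norm_eq_abs]
      nlinarith
    refine h1.trans ((meas_ge_le_mul_pow_eLpNorm_enorm μ
      (ENNReal.ofReal_pos.2 hq).ne' ENNReal.ofReal_ne_top
      hVm.aestronglyMeasurable (by simpa using ht) (fun h => absurd h (by simp))).trans ?_)
    rw [ENNReal.toReal_ofReal hq.le]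
    calc _ ≤ (ENNReal.ofReal (M * s * D))⁻¹ ^ q * ENNReal.ofReal (C * s) ^ q := by gcongr
      _ = ENNReal.ofReal ((M * s * D)⁻¹ ^ q * (C * s) ^ q) := by
        rw [← ENNReal.ofReal_inv_of_pos ht, ENNReal.ofReal_rpow_of_nonneg (by positivity) hq.le,
          ENNReal.ofReal_rpow_of_nonneg (by positivity) hq.le, ENNReal.ofReal_mul (by positivity)]
      _ = _ := by
        congr 1
        rw [← Real.mul_rpow (by positivity) (by positivity), ← hDq,
          ← Real.div_rpow (by positivity) hD]
        congr 1
        field_simp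
  calc _ ≤ ∑ jk : Fin d × Fin d, μ {ω | M * (s * D + β) < |A ω jk.1 jk.2|} :=
        (measure_mono hsub).trans (measure_iUnion_fintype_le _ _)
    _ ≤ ∑ _jk : Fin d × Fin d, ENNReal.ofReal ((C / M) ^ q / (d : ℝ) ^ 2) :=
        Finset.sum_le_sum fun jk _ => hentry jk
    _ = ENNReal.ofReal ((d : ℝ) ^ 2 * ((C / M) ^ q / (d : ℝ) ^ 2)) := by
        rw [Finset.sum_const, Finset.card_univ, Fintype.card_prod, Fintype.card_fin, nsmul_eq_mul,
          ENNReal.ofReal_mul (by positivity)]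
        congr 1
        push_cast
        rw [ENNReal.ofReal_pow (by positivity), ENNReal.ofReal_natCast, sq]
    _ ≤ _ := by
        refine ENNReal.ofReal_le_ofReal ?_
        rcases Nat.eq_zero_or_pos d with rfl | hd
        · have : 0 ≤ (C / M) ^ q := by positivity
          simpa using this
        · have : (0 : ℝ) < (d : ℝ) ^ 2 := by positivity
          rw [mul_div_cancel₀ _ this.ne']

variable [IsProbabilityMeasure μ]

/-- Chebyshev's inequality for the Frobenius norm of a random matrix whose entries are constants of
size at most `C s` plus variables of `L²` norm at most `C s`. -/
lemma measure_frobNorm_gt_le {d : ℕ} {A : Ω → Matrix (Fin d) (Fin d) ℝ} {C s M : ℝ}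
    (hC : 0 < C) (hs : 0 < s) (hM : 0 < M)
    (hA : ∀ j k, ∃ (b : ℝ) (V : Ω → ℝ), Measurable V ∧ (∀ᵐ ω ∂μ, A ω j k = b + V ω) ∧
      |b| ≤ C * s ∧ eLpNorm V 2 μ ≤ ENNReal.ofReal (C * s)) :
    μ {ω | M * (d * s) < |frobNorm (A ω)|} ≤ ENNReal.ofReal ((2 * C / M) ^ 2) := by
  rcases Nat.eq_zero_or_pos d with rfl | hd
  · simp [frobNorm]
  choose b V hVm hAV hb hV using hA
  have ht : 0 < M * (d * s) := by positivity
  have hsub : μ {ω | M * (d * s) < |frobNorm (A ω)|} ≤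
      μ {ω | ENNReal.ofReal ((M * (d * s)) ^ 2) ≤ ∑ j, ∑ k, ‖b j k + V j k ω‖ₑ ^ 2} := by
    refine measure_mono_ae ?_
    have hall : ∀ᵐ ω ∂μ, ∀ j k, A ω j k = b j k + V j k ω :=
      ae_all_iff.2 fun j => ae_all_iff.2 fun k => hAV j k
    filter_upwards [hall] with ω hω hlt
    have h1 : M * (d * s) < |frobNorm (A ω)| := hlt
    change ENNReal.ofReal ((M * (d * s)) ^ 2) ≤ ∑ j, ∑ k, ‖b j k + V j k ω‖ₑ ^ 2
    have h2 : (M * (d * s)) ^ 2 ≤ ∑ j, ∑ k, A ω j k ^ 2 := by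
      have h3 : (M * (d * s)) ^ 2 ≤ |frobNorm (A ω)| ^ 2 := pow_le_pow_left₀ ht.le h1.le 2
      rwa [sq_abs, frobNorm, Real.sq_sqrt (by positivity)] at h3
    refine (ENNReal.ofReal_le_ofReal h2).trans (le_of_eq ?_)
    rw [ENNReal.ofReal_sum_of_nonneg fun j _ => by positivity]
    refine Finset.sum_congr rfl fun j _ => ?_
    rw [ENNReal.ofReal_sum_of_nonneg fun k _ => by positivity]
    refine Finset.sum_congr rfl fun k _ => ?_
    rw [hω j k, ← ofReal_norm, ← ENNReal.ofReal_pow (norm_nonneg _), Real.norm_eq_abs, sq_abs]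
  have hentry : ∀ j k, ∫⁻ ω, ‖b j k + V j k ω‖ₑ ^ 2 ∂μ ≤ ENNReal.ofReal ((2 * (C * s)) ^ 2) := by
    intro j k
    have h1 : eLpNorm (fun ω => b j k + V j k ω) 2 μ ≤ ENNReal.ofReal (2 * (C * s)) := by
      refine (eLpNorm_add_le (f := fun _ => b j k) aestronglyMeasurable_const
        (hVm j k).aestronglyMeasurable (by norm_num)).trans ?_
      rw [two_mul, ENNReal.ofReal_add (by positivity) (by positivity)]
      refine add_le_add ?_ (hV j k)
      rw [eLpNorm_const _ (by norm_num) (IsProbabilityMeasure.ne_zero μ)]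
      simp only [measure_univ, ENNReal.one_rpow, mul_one]
      rw [← ofReal_norm, Real.norm_eq_abs]
      exact ENNReal.ofReal_le_ofReal (hb j k)
    have h2 := lintegral_enorm_rpow_eq_eLpNorm_rpow (μ := μ) (q := 2) (by norm_num)
      (fun ω => b j k + V j k ω)
    simp only [ENNReal.ofReal_ofNat, ENNReal.rpow_ofNat] at h2
    rw [h2, ENNReal.ofReal_pow (by positivity)]
    gcongr
  have hmeas : ∀ j k, Measurable fun ω => ‖b j k + V j k ω‖ₑ ^ 2 := fun j k =>
    ((measurable_const.add (hVm j k)).enorm).pow_const 2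
  have hcheb := mul_meas_ge_le_lintegral (μ := μ)
    (f := fun ω => ∑ j, ∑ k, ‖b j k + V j k ω‖ₑ ^ 2)
    (Finset.measurable_fun_sum _ fun j _ => Finset.measurable_fun_sum _ fun k _ => hmeas j k)
    (ENNReal.ofReal ((M * (d * s)) ^ 2))
  have hint : ∫⁻ ω, ∑ j, ∑ k, ‖b j k + V j k ω‖ₑ ^ 2 ∂μ ≤
      ENNReal.ofReal ((d : ℝ) ^ 2 * (2 * (C * s)) ^ 2) := by
    rw [lintegral_finsetSum _ fun j _ => Finset.measurable_fun_sum _ fun k _ => hmeas j k]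
    calc _ ≤ ∑ _j : Fin d, ∑ _k : Fin d, ENNReal.ofReal ((2 * (C * s)) ^ 2) := by
          refine Finset.sum_le_sum fun j _ => ?_
          rw [lintegral_finsetSum _ fun k _ => hmeas j k]
          exact Finset.sum_le_sum fun k _ => hentry j k
      _ = _ := by
          simp only [Finset.sum_const, Finset.card_univ, Fintype.card_fin, nsmul_eq_mul]
          rw [ENNReal.ofReal_mul (by positivity), ENNReal.ofReal_pow (by positivity : (0 : ℝ) ≤ d),
            ENNReal.ofReal_natCast]
          ring
  refine hsub.trans ?_
  have h3 := hcheb.trans hint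
  rw [mul_comm, ← ENNReal.le_div_iff_mul_le (Or.inl (ENNReal.ofReal_pos.2 (by positivity)).ne')
    (Or.inl ENNReal.ofReal_ne_top), ← ENNReal.ofReal_div_of_pos (by positivity)] at h3
  refine h3.trans (le_of_eq ?_)
  congr 1
  field_simp

end

lemma exists_bound_rpow_le {q C ε : ℝ} (hq : 1 ≤ q) (hC : 0 < C) (hε : 0 < ε) :
    ∃ M : ℝ, C ≤ M ∧ (C / M) ^ q ≤ ε := by
  refine ⟨C + C / ε, by have : 0 < C / ε := by positivity
                        linarith, ?_⟩
  have e : C / (C + C / ε) = ε / (ε + 1) := by field_simp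
  have h1 : ε / (ε + 1) ≤ 1 := by rw [div_le_one (by positivity)]; linarith
  have h2 : ε / (ε + 1) ≤ ε := div_le_self hε.le (by linarith)
  rw [e]
  exact (Real.rpow_le_self_of_le_one (by positivity) h1 hq).trans h2

/-! ### Bernoulli shifts and their dependence coefficients -/

/-- A series is finite if its terms are finite and eventually dominated by a summable sequence. -/
lemma tsum_ne_top_of_eventually_le {f : ℕ → ℝ≥0∞} {g : ℕ → ℝ} (hf : ∀ m, f m ≠ ∞)
    (hg : Summable g) (hfg : ∀ᶠ m in atTop, f m ≤ ENNReal.ofReal (g m)) : ∑' m, f m ≠ ∞ := by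
  obtain ⟨m₁, hm₁⟩ := eventually_atTop.1 hfg
  have hle : ∀ m, f m ≤ ENNReal.ofReal (g m) + if m ∈ Finset.range m₁ then f m else 0 := fun m => by
    by_cases hm : m < m₁
    · simp [hm]
    · simpa [hm] using hm₁ m (not_lt.1 hm)
  refine ne_top_of_le_ne_top ?_ (ENNReal.tsum_le_tsum hle)
  rw [ENNReal.tsum_add, ENNReal.add_ne_top]
  refine ⟨hg.tsum_ofReal_ne_top, ?_⟩
  rw [tsum_eq_sum (s := Finset.range m₁) fun m hm => if_neg hm]
  exact ENNReal.sum_ne_top.2 fun m hm => by rw [if_pos hm]; exact hf m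

/-- Polynomial decay of order faster than two makes the weighted sum of the dependence coefficients
finite. -/
lemma tsum_succ_mul_ne_top {ϑ : ℕ → ℝ≥0∞} (hfin : ∀ m, ϑ m ≠ ∞) {χ A C : ℝ} (hχ : 1 < χ)
    (hA : 0 < A) (hdecay : ∀ᶠ m : ℕ in atTop, ϑ m ≤
      ENNReal.ofReal (C * (((m : ℝ) + 1) ^ (-(χ + 1)) * Real.log ((m : ℝ) + 1) ^ (-A)))) :
    ∑' m : ℕ, ((m : ℝ≥0∞) + 1) * ϑ m ≠ ∞ := by
  have hsum : Summable fun m : ℕ => |C| * ((m : ℝ) + 1) ^ (-χ) := by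
    refine Summable.mul_left _ ?_
    have h := (summable_nat_add_iff 1).2 (Real.summable_nat_rpow.2 (by linarith : -χ < -1))
    exact h.congr fun m => by push_cast; rfl
  refine tsum_ne_top_of_eventually_le (fun m => ENNReal.mul_ne_top
    (ENNReal.add_ne_top.2 ⟨ENNReal.natCast_ne_top m, ENNReal.one_ne_top⟩) (hfin m)) hsum ?_
  filter_upwards [hdecay, eventually_ge_atTop 2] with m hm hm2
  have hm0 : (0 : ℝ) < (m : ℝ) + 1 := by positivity
  have h3 : (3 : ℝ) ≤ (m : ℝ) + 1 := by
    have : (2 : ℝ) ≤ m := by exact_mod_cast hm2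
    linarith
  have hlog : 1 ≤ Real.log ((m : ℝ) + 1) := by
    rw [Real.le_log_iff_exp_le hm0]
    exact Real.exp_one_lt_three.le.trans h3
  have hlogA : Real.log ((m : ℝ) + 1) ^ (-A) ≤ 1 :=
    Real.rpow_le_one_of_one_le_of_nonpos hlog (by linarith)
  have hcast : (m : ℝ≥0∞) + 1 = ENNReal.ofReal ((m : ℝ) + 1) := by
    rw [ENNReal.ofReal_add (by positivity) zero_le_one, ENNReal.ofReal_natCast, ENNReal.ofReal_one]
  have hlog0 : 0 ≤ Real.log ((m : ℝ) + 1) ^ (-A) := Real.rpow_nonneg (by linarith) _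
  have hpow : ((m : ℝ) + 1) * ((m : ℝ) + 1) ^ (-(χ + 1)) = ((m : ℝ) + 1) ^ (-χ) := by
    nth_rewrite 1 [← Real.rpow_one ((m : ℝ) + 1)]
    rw [← Real.rpow_add hm0]; congr 1; ring
  rw [hcast]
  refine (mul_le_mul' le_rfl hm).trans ?_
  rw [← ENNReal.ofReal_mul hm0.le]
  refine ENNReal.ofReal_le_ofReal ?_
  calc _ = C * (((m : ℝ) + 1) ^ (-χ) * Real.log ((m : ℝ) + 1) ^ (-A)) := by rw [← hpow]; ring
    _ ≤ |C| * (((m : ℝ) + 1) ^ (-χ) * 1) := by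
      gcongr
      exact le_abs_self C
    _ = _ := by rw [mul_one]

section

variable {Ω E : Type*} {d : ℕ}

/-- The innovations up to time `n`, counted backwards from time `n`. -/
def backward (e : ℤ → Ω → E) (n : ℤ) (k : ℕ) : Ω → E := e (n - k)

/-- The coordinate `j` of the vector at time `a ≤ n` as a function of the innovations up to time
`n`. -/
def coordFun (G : ℕ → (ℕ → E) → Fin d → ℝ) (n : ℕ) (j : Fin d) (a : ℕ) (y : ℕ → E) : ℝ :=
  G a (fun m => y (m + (n - a))) j

lemma coordFun_innov {e : ℤ → Ω → E} {G : ℕ → (ℕ → E) → Fin d → ℝ} {n a : ℕ} (ha : a ≤ n)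
    (j : Fin d) (ω : Ω) :
    coordFun G n j a (innov (backward e n) ω) = bernoulliShift e G a ω j := by
  unfold coordFun bernoulliShift
  congr 1
  funext m
  simp only [innov, backward, past]
  congr 1
  push_cast [Nat.cast_sub ha]
  ring

lemma coordFun_resample {e : ℤ → Ω → E} {G : ℕ → (ℕ → E) → Fin d → ℝ} {n a : ℕ} (ha : a ≤ n)
    (j : Fin d) (k : ℕ) (z : Ω × Ω) :
    coordFun G n j a (resample (backward e n) k z) =
      if n - a ≤ k then coupledShift e G a (k - (n - a)) z j else bernoulliShift e G a z.1 j := by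
  split_ifs with hk
  · unfold coordFun coupledShift
    congr 1
    funext m
    by_cases hm : m = k - (n - a)
    · subst hm
      have h1 : k - (n - a) + (n - a) = k := Nat.sub_add_cancel hk
      have h2 : ((n : ℤ) - k) = (a : ℤ) - ((k - (n - a) : ℕ) : ℤ) := by omega
      simp only [resample, h1, Function.update_self, backward, h2]
    · have h1 : m + (n - a) ≠ k := by omega
      have h2 : (n : ℤ) - ((m + (n - a) : ℕ) : ℤ) = (a : ℤ) - m := by omega
      simp only [resample, Function.update_of_ne h1, Function.update_of_ne hm, innov, backward,
        past, h2]
  · rw [← coordFun_innov (n := n) ha]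
    unfold coordFun
    congr 1
    funext m
    have h1 : m + (n - a) ≠ k := by omega
    simp only [resample, Function.update_of_ne h1]

variable [MeasurableSpace Ω] [MeasurableSpace E]

lemma measurable_coordFun {G : ℕ → (ℕ → E) → Fin d → ℝ} {n a : ℕ} (hG : Measurable (G a))
    (j : Fin d) : Measurable (coordFun G n j a) :=
  (measurable_pi_apply j).comp (hG.comp (measurable_pi_lambda _ fun _ => measurable_pi_apply _))

variable {μ : Measure Ω}

lemma measurable_bernoulliShift {e : ℤ → Ω → E} (he : ∀ s, Measurable (e s))
    {G : ℕ → (ℕ → E) → Fin d → ℝ} {a : ℕ} (hG : Measurable (G a)) :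
    Measurable (bernoulliShift e G a) :=
  hG.comp (measurable_pi_lambda _ fun _ => he _)

lemma memLp_of_lintegral_le {X : Ω → ℝ} {p : ℝ} (hp : 0 < p) (hX : Measurable X) {c : ℝ≥0}
    (h : ∫⁻ ω, ENNReal.ofReal (|X ω| ^ p) ∂μ ≤ c) :
    MemLp X (ENNReal.ofReal p) μ ∧ eLpNorm X (ENNReal.ofReal p) μ ≤ (c : ℝ≥0∞) ^ (1 / p) := by
  have e : ∫⁻ ω, ENNReal.ofReal (|X ω| ^ p) ∂μ = eLpNorm X (ENNReal.ofReal p) μ ^ p := by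
    rw [← lintegral_enorm_rpow_eq_eLpNorm_rpow hp]
    refine lintegral_congr fun ω => ?_
    rw [← ENNReal.ofReal_rpow_of_nonneg (abs_nonneg _) hp.le, ← Real.norm_eq_abs, ofReal_norm]
  rw [e] at h
  have h2 : eLpNorm X (ENNReal.ofReal p) μ ≤ (c : ℝ≥0∞) ^ (1 / p) := by
    rwa [one_div, ENNReal.le_rpow_inv_iff hp]
  exact ⟨⟨hX.aestronglyMeasurable, h2.trans_lt
    (ENNReal.rpow_lt_top_of_nonneg (by positivity) ENNReal.coe_ne_top)⟩, h2⟩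

variable [IsProbabilityMeasure μ]

/-- The coupled vector has the law of the original one, so that the dependence coefficients are at
most twice the moments. -/
lemma eLpNorm_coupled_le {e : ℤ → Ω → E} (he : ∀ s, Measurable (e s)) (hind : iIndepFun e μ)
    {G : ℕ → (ℕ → E) → Fin d → ℝ} {a : ℕ} (hG : Measurable (G a)) (j : Fin d) (k : ℕ) {q : ℝ≥0∞}
    (hq : 1 ≤ q) :
    eLpNorm (fun z : Ω × Ω => bernoulliShift e G a z.1 j - coupledShift e G a k z j) q
      (μ.prod μ) ≤ 2 * eLpNorm (fun ω => bernoulliShift e G a ω j) q μ := by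
  have hb : ∀ i, Measurable (backward e a i) := fun i => he _
  have hbi : iIndepFun (backward e a) μ :=
    hind.precomp (g := fun i : ℕ => (a : ℤ) - i) fun i i' h => by simpa using h
  have hf : Measurable fun y : ℕ → E => G a y j := (measurable_pi_apply j).comp hG
  have m1 : AEStronglyMeasurable (fun z : Ω × Ω => bernoulliShift e G a z.1 j) (μ.prod μ) :=
    (((measurable_pi_apply j).comp (measurable_bernoulliShift he hG)).comp
      measurable_fst).aestronglyMeasurable
  have m2 : AEStronglyMeasurable (fun z : Ω × Ω => coupledShift e G a k z j) (μ.prod μ) :=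
    (hf.comp (measurable_resample hb k)).aestronglyMeasurable
  refine (eLpNorm_sub_le m1 m2 hq).trans ?_
  rw [two_mul]
  refine add_le_add (le_of_eq ?_) (le_of_eq ?_)
  · exact eLpNorm_comp_measurePreserving (g := fun ω => bernoulliShift e G a ω j)
      ((measurable_pi_apply j).comp (measurable_bernoulliShift he hG)).aestronglyMeasurable
      measurePreserving_fst
  · exact eLpNorm_comp_resample hb hbi hf k q

end

/-! ### Entries of the covariance error -/

/-- The constant in the bounds for the entries of the covariance error, in terms of the moment order
and of the dependence coefficients only. -/
noncomputable def errorConst (p : ℝ) (ϑ : ℕ → ℝ≥0∞) : ℝ :=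
  4 * (∑' m, ϑ m).toReal ^ 2 + 2 * ((∑' m, ϑ m).toReal * (∑' m : ℕ, m * ϑ m).toReal) +
    4 * √(martConst (p / 2) * martConst p) * (∑' m, ϑ m).toReal ^ 2 + 1

lemma errorConst_pos (p : ℝ) (ϑ : ℕ → ℝ≥0∞) : 0 < errorConst p ϑ := by
  unfold errorConst; positivity

section

variable {Ω E : Type*} [MeasurableSpace Ω] [MeasurableSpace E] {d : ℕ} {μ : Measure Ω}
  [IsProbabilityMeasure μ]

/-- The fluctuation part of an entry of the covariance error has order `√(L / n)`. -/
lemma CenteredRow.eLpNorm_normalized_le {ε : ℕ → Ω → E} {ϑ : ℕ → ℝ≥0∞} {p : ℝ} {n N L : ℕ}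
    {F F' : ℕ → (ℕ → E) → ℝ} (h : CenteredRow μ ε ϑ p n F) (h' : CenteredRow μ ε ϑ p n F')
    (hε : ∀ k, Measurable (ε k)) (hind : iIndepFun ε μ) (hp : 4 ≤ p) (hϑ : ∑' m, ϑ m ≠ ∞)
    (hL : 1 ≤ L) (hN : 1 ≤ N) (hn : N + L = n + 1) :
    eLpNorm (fun ω => -(1 / (L * N : ℝ)) * (blockProd F F' N L (innov ε ω) -
      ∫ ω', blockProd F F' N L (innov ε ω') ∂μ)) (ENNReal.ofReal (p / 2)) μ ≤
      ENNReal.ofReal (errorConst p ϑ * √(L / n)) := by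
  set τ := (∑' m, ϑ m).toReal with hτ
  have hτe : ∑' m, ϑ m = ENNReal.ofReal τ := (ENNReal.ofReal_toReal hϑ).symm
  have hτ0 : 0 ≤ τ := ENNReal.toReal_nonneg
  set K : ℝ := martConst (p / 2) * martConst p with hK
  have hK0 : 0 ≤ K := by positivity
  have hL0 : (1 : ℝ) ≤ L := by exact_mod_cast hL
  have hN0 : (1 : ℝ) ≤ N := by exact_mod_cast hN
  have hnR : (N : ℝ) + L = n + 1 := by exact_mod_cast hn
  have hn0 : (0 : ℝ) < n := by linarith
  have h1 := h.eLpNorm_blockProd_sub_sq_le h' hε hind hp hn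
  have h2 : martConst (p / 2) * (4 * (martConst p * (L * (∑' m, ϑ m) ^ 2)) * (min L N : ℕ) ^ 2 *
        (n * (∑' m, ϑ m) ^ 2)) = ENNReal.ofReal (4 * K * τ ^ 4 * (L * n * (min L N : ℕ) ^ 2)) := by
    rw [hτe, ← ENNReal.ofReal_pow hτ0, ← ENNReal.ofReal_natCast L, ← ENNReal.ofReal_natCast n,
      ← ENNReal.ofReal_natCast (min L N), ← ENNReal.ofReal_coe_nnreal (p := martConst p),
      ← ENNReal.ofReal_coe_nnreal (p := martConst (p / 2)), ← ENNReal.ofReal_pow (by positivity),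
      ← ENNReal.ofReal_ofNat 4, ← ENNReal.ofReal_mul (by positivity),
      ← ENNReal.ofReal_mul (by positivity), ← ENNReal.ofReal_mul (by positivity),
      ← ENNReal.ofReal_mul (by positivity), ← ENNReal.ofReal_mul (by positivity),
      ← ENNReal.ofReal_mul (by positivity), ← ENNReal.ofReal_mul (by positivity)]
    congr 1
    ring
  -- the product of `min L N` and `max L N` is `L N`, and `n ≤ 2 max L N`
  have hmin : ((min L N : ℕ) : ℝ) * n ≤ 2 * (L * N) := by
    rw [Nat.cast_min, ← min_mul_max (L : ℝ) N]
    have : (n : ℝ) ≤ 2 * max (L : ℝ) N := by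
      linarith [le_max_left (L : ℝ) N, le_max_right (L : ℝ) N]
    have h0 : (0 : ℝ) ≤ min (L : ℝ) N := by positivity
    nlinarith
  have hreal : (1 / (L * N : ℝ)) ^ 2 * (4 * K * τ ^ 4 * (L * n * (min L N : ℕ) ^ 2)) ≤
      (4 * √K * τ ^ 2 * √(L / n)) ^ 2 := by
    have e : (4 * √K * τ ^ 2 * √(L / n)) ^ 2 = 16 * K * τ ^ 4 * (L / n) := by
      rw [mul_pow, mul_pow, mul_pow, Real.sq_sqrt hK0, Real.sq_sqrt (by positivity)]; ring
    rw [e]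
    calc (1 / (L * N : ℝ)) ^ 2 * (4 * K * τ ^ 4 * (L * n * (min L N : ℕ) ^ 2))
        = 4 * K * τ ^ 4 * (L / n) * (((min L N : ℕ) * n) ^ 2 / (L * N) ^ 2) := by
          field_simp
      _ ≤ 4 * K * τ ^ 4 * (L / n) * 4 := by
          gcongr
          rw [div_le_iff₀ (by positivity)]
          calc (((min L N : ℕ) : ℝ) * n) ^ 2 ≤ (2 * (L * N)) ^ 2 := by gcongr
            _ = _ := by ring
      _ = _ := by ring
  have h3 : eLpNorm (fun ω => -(1 / (L * N : ℝ)) * (blockProd F F' N L (innov ε ω) -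
      ∫ ω', blockProd F F' N L (innov ε ω') ∂μ)) (ENNReal.ofReal (p / 2)) μ ^ 2 ≤
      ENNReal.ofReal (4 * √K * τ ^ 2 * √(L / n)) ^ 2 := by
    have e := eLpNorm_const_smul (-(1 / (L * N : ℝ))) (fun ω => blockProd F F' N L (innov ε ω) -
      ∫ ω', blockProd F F' N L (innov ε ω') ∂μ) (ENNReal.ofReal (p / 2)) μ
    change eLpNorm (-(1 / (L * N : ℝ)) • _) _ _ ^ 2 ≤ _
    rw [e, mul_pow, enorm_neg, ← ofReal_norm, Real.norm_of_nonneg (by positivity),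
      ← ENNReal.ofReal_pow (by positivity), ← ENNReal.ofReal_pow (by positivity)]
    refine (mul_le_mul' le_rfl (h1.trans h2.le)).trans ?_
    rw [← ENNReal.ofReal_mul (by positivity)]
    exact ENNReal.ofReal_le_ofReal hreal
  refine ((ENNReal.pow_le_pow_left_iff two_ne_zero).1 h3).trans (ENNReal.ofReal_le_ofReal ?_)
  unfold errorConst
  rw [← hτ, ← hK]
  gcongr
  have : 0 ≤ τ * (∑' m : ℕ, m * ϑ m).toReal := by positivity
  nlinarith [sq_nonneg τ]

/-- Every entry of the covariance error is, almost surely, the sum of a small deterministic bias and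
of a centered random variable with a small moment of order `p / 2`. -/
theorem exists_bias_add_fluctuation {e : ℤ → Ω → E} (he : ∀ s, Measurable (e s))
    (hind : iIndepFun e μ) {G : ℕ → (ℕ → E) → Fin d → ℝ} {n L : ℕ}
    (hG : ∀ i ∈ Finset.Icc 1 n, Measurable (G i)) (hL1 : 1 ≤ L) (hLn : L ≤ n)
    {B : ℕ → Ω → ℝ} (hB_meas : ∀ i, Measurable (B i))
    (hB_law : ∀ i, Measure.map (B i) μ = gaussianReal 0 1) (hB_indep : iIndepFun B μ)
    (hB_data : IndepFun (fun ω i => B i ω) (sample n (bernoulliShift e G)) μ)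
    {ϑ : ℕ → ℝ≥0∞} {p : ℝ} (hp : 4 ≤ p) (hϑ : ∑' m, ϑ m ≠ ∞) (hϑ' : ∑' m : ℕ, m * ϑ m ≠ ∞)
    (hrow : ∀ j, CenteredRow μ (backward e n) ϑ p n (coordFun G n j)) (j k : Fin d) :
    ∃ (b : ℝ) (V : Ω → ℝ), Measurable V ∧
      (∀ᵐ ω ∂μ, covError n L μ (bernoulliShift e G) B ω j k = b + V ω) ∧
      |b| ≤ errorConst p ϑ * ((L : ℝ) / n + 1 / L) ∧
      eLpNorm V (ENNReal.ofReal (p / 2)) μ ≤ ENNReal.ofReal (errorConst p ϑ * √(L / n)) := by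
  set N := n - L + 1 with hN
  have hn : N + L = n + 1 := by omega
  have hN1 : 1 ≤ N := by omega
  set ε := backward e n with hε
  have hεm : ∀ i, Measurable (ε i) := fun i => he _
  have hεi : iIndepFun ε μ :=
    hind.precomp (g := fun i : ℕ => (n : ℤ) - i) fun i i' h => by simpa using h
  have hX : ∀ j (P : Finset ℕ), P ⊆ Finset.Icc 1 n → ∀ ω,
      ∑ a ∈ P, bernoulliShift e G a ω j = partSum (coordFun G n j) P (innov ε ω) :=
    fun j P hP ω => Finset.sum_congr rfl fun a ha =>
      (coordFun_innov (Finset.mem_Icc.1 (hP ha)).2 j ω).symm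
  set W := blockProd (coordFun G n j) (coordFun G n k) N L with hW
  set Γ := covariance (partSum (coordFun G n j) (Finset.Icc 1 n) ∘ innov ε)
    (partSum (coordFun G n k) (Finset.Icc 1 n) ∘ innov ε) μ with hΓ
  have hWm : Measurable W := (hrow j).measurable_blockProd (hrow k) hn
  refine ⟨Γ / n - (∫ ω, W (innov ε ω) ∂μ) / (L * N),
    fun ω => -(1 / (L * N : ℝ)) * (W (innov ε ω) - ∫ ω', W (innov ε ω') ∂μ), ?_, ?_, ?_, ?_⟩
  · exact ((hWm.comp (measurable_innov hεm)).sub_const _).const_mul _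
  · have hx2 : ∀ i ∈ Finset.Icc 1 n, ∀ j, MemLp (fun ω => bernoulliShift e G i ω j) 2 μ :=
      fun i hi j => by
        have h1 := (hrow j).memLp_two_partSum hp (P := {i}) (by simpa using hi)
        have h2 : partSum (coordFun G n j) {i} ∘ innov ε = fun ω => bernoulliShift e G i ω j := by
          funext ω
          rw [Function.comp_apply, ← hX j {i} (by simpa using hi), Finset.sum_singleton]
        rwa [h2] at h1
    have hcond := condCovMat_normBootStat hL1 hLn
      (fun i hi => measurable_bernoulliShift he (hG i hi)) hx2 hB_meas hB_law hB_indep hB_data j k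
    have hcov : covMat μ (normSum n (bernoulliShift e G)) j k = Γ / n := by
      simp only [covMat, normSum, Matrix.of_apply]
      rw [covariance_fun_div_left, covariance_fun_div_right, div_div,
        Real.mul_self_sqrt (Nat.cast_nonneg n), hΓ]
      congr 2
      · funext ω; exact hX j _ subset_rfl ω
      · funext ω; exact hX k _ subset_rfl ω
    filter_upwards [hcond] with ω hω
    have hWω : ∑ i ∈ Finset.Icc 1 N, (∑ l ∈ Finset.Ico i (i + L), bernoulliShift e G l ω j) *
        ∑ l ∈ Finset.Ico i (i + L), bernoulliShift e G l ω k = W (innov ε ω) :=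
      Finset.sum_congr rfl fun i hi => by
        rw [hX j _ (block_subset hn hi), hX k _ (block_subset hn hi)]
    rw [covError, Matrix.sub_apply, hcov, hω, hWω]
    ring
  · refine ((hrow j).abs_covariance_sub_integral_blockProd_le (hrow k) hεm hεi hp hϑ hϑ' hL1 hN1
      hn).trans ?_
    unfold errorConst
    set τ := (∑' m, ϑ m).toReal
    set τ₁ := (∑' m : ℕ, m * ϑ m).toReal
    have h1 : 0 ≤ τ * τ₁ := by positivity
    have h2 : 0 ≤ √(martConst (p / 2) * martConst p : ℝ) * τ ^ 2 := by positivity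
    rw [mul_add]
    gcongr
    · linarith
    · linarith [sq_nonneg τ]
  · exact (hrow j).eLpNorm_normalized_le (hrow k) hεm hεi hp hϑ hL1 hN1 hn

end

/-! ### Rates in probability -/

theorem lemma4p1
    {Ω : ℕ → Type*} [∀ n, MeasurableSpace (Ω n)]
    (μ : ∀ n, Measure (Ω n)) [∀ n, IsProbabilityMeasure (μ n)]
    {E : ℕ → Type*} [∀ n, MeasurableSpace (E n)]
    (d : ℕ → ℕ)
    -- i.i.d. innovations, row by row
    (e : ∀ n, ℤ → Ω n → E n)
    (he_meas : ∀ n s, Measurable (e n s))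
    (he_indep : ∀ n, iIndepFun (e n) (μ n))
    (he_ident : ∀ n s, IdentDistrib (e n s) (e n 0) (μ n) (μ n))
    -- the measurable filters and the centered triangular array they generate
    (G : ∀ n, ℕ → (ℕ → E n) → Fin (d n) → ℝ)
    (hG_meas : ∀ n, ∀ i ∈ Finset.Icc 1 n, Measurable (G n i))
    (x : ∀ n, ℕ → Ω n → Fin (d n) → ℝ)
    (hx : ∀ n i, x n i = bernoulliShift (e n) (G n) i)
    (hx_centered : ∀ n, ∀ i ∈ Finset.Icc 1 n, ∀ j, ∫ ω, x n i ω j ∂(μ n) = 0)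
    -- nondegeneracy and uniformly bounded moments of order `p ≥ 4`
    (hnondeg : ∃ lam : ℝ, 0 < lam ∧
      ∀ n, 1 ≤ n → ∀ t ∈ spectrum ℝ (covMat (μ n) (normSum n (x n))), lam ≤ t)
    (p : ℝ) (hp : 4 ≤ p)
    (hmoment : ∃ Cp : NNReal, ∀ n, ∀ i ∈ Finset.Icc 1 n, ∀ j,
      ∫⁻ ω, ENNReal.ofReal (|x n i ω j| ^ p) ∂(μ n) ≤ Cp)
    -- polynomially decaying dependence, uniformly over the coordinates
    (χ A : ℝ) (hχ : 1 < χ) (hA : √(χ + 1) < A)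
    (hdep : ∃ C : ℝ, ∀ᶠ m : ℕ in atTop, ∀ j : ℕ,
      physDep μ e G m j p ≤
        ENNReal.ofReal (C * (((m : ℝ) + 1) ^ (-(χ + 1)) * Real.log ((m : ℝ) + 1) ^ (-A))))
    -- window sizes
    (L : ℕ → ℕ) (hL : ∀ n, 1 ≤ n → 1 ≤ L n ∧ L n ≤ n)
    -- i.i.d. standard normal multipliers, independent of the data
    (B : ∀ n, ℕ → Ω n → ℝ)
    (hB_meas : ∀ n i, Measurable (B n i))
    (hB_law : ∀ n i, Measure.map (B n i) (μ n) = gaussianReal 0 1)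
    (hB_indep : ∀ n, iIndepFun (B n) (μ n))
    (hB_data : ∀ n, IndepFun (fun ω i => B n i ω) (sample n (x n)) (μ n)) :
    BoundedInProb μ (fun n ω => frobNorm (covError n (L n) (μ n) (x n) (B n) ω))
      (fun n => (d n : ℝ) * (√((L n : ℝ) / (n : ℝ)) + 1 / (L n : ℝ))) ∧
    BoundedInProb μ (fun n ω => maxNorm (covError n (L n) (μ n) (x n) (B n) ω))
      (fun n => √((L n : ℝ) / (n : ℝ)) * (d n : ℝ) ^ (4 / p) + (L n : ℝ) / (n : ℝ)
        + 1 / (L n : ℝ)) := by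
  obtain rfl : x = fun n => bernoulliShift (e n) (G n) := funext fun n => funext fun i => hx n i
  obtain ⟨Cp, hCp⟩ := hmoment
  obtain ⟨C₀, hC₀⟩ := hdep
  have hp0 : 0 < p := by linarith
  have hp1 : 1 ≤ ENNReal.ofReal p := by simpa using (by linarith : (1 : ℝ) ≤ p)
  set ϑ : ℕ → ℝ≥0∞ := fun m => ⨆ j, physDep μ e G m j p with hϑdef
  have hcoord : ∀ n, ∀ i ∈ Finset.Icc 1 n, ∀ j,
      Measurable fun ω => bernoulliShift (e n) (G n) i ω j := fun n i hi j =>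
    (measurable_pi_apply j).comp (measurable_bernoulliShift (he_meas n) (hG_meas n i hi))
  have hLp := fun n i hi j => memLp_of_lintegral_le hp0 (hcoord n i hi j) (hCp n i hi j)
  -- the decay is only assumed for large lags; at the other lags the moment bound gives finiteness
  have hfin : ∀ m, ϑ m ≠ ∞ := fun m => by
    refine ne_top_of_le_ne_top (b := 2 * (Cp : ℝ≥0∞) ^ (1 / p)) (ENNReal.mul_ne_top (by simp)
      (ENNReal.rpow_ne_top_of_nonneg (by positivity) ENNReal.coe_ne_top)) ?_
    refine iSup_le fun j => iSup_le fun n => iSup₂_le fun i hi => iSup_le fun hj => ?_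
    refine (eLpNorm_coupled_le (he_meas n) (he_indep n) (hG_meas n i hi) ⟨j, hj⟩ m hp1).trans ?_
    exact mul_le_mul' le_rfl (hLp n i hi ⟨j, hj⟩).2
  have hsum : ∑' m : ℕ, ((m : ℝ≥0∞) + 1) * ϑ m ≠ ∞ :=
    tsum_succ_mul_ne_top hfin hχ ((Real.sqrt_nonneg _).trans_lt hA)
      (hC₀.mono fun m hm => iSup_le hm)
  have hϑ : ∑' m, ϑ m ≠ ∞ := ne_top_of_le_ne_top hsum
    (ENNReal.tsum_le_tsum fun m => le_mul_of_one_le_left zero_le le_add_self)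
  have hϑ' : ∑' m : ℕ, m * ϑ m ≠ ∞ := ne_top_of_le_ne_top hsum
    (ENNReal.tsum_le_tsum fun m => mul_le_mul' le_self_add le_rfl)
  have hrow : ∀ n j, CenteredRow (μ n) (backward (e n) n) ϑ p n (coordFun (G n) n j) := by
    intro n j
    have hshift : ∀ a ∈ Finset.Icc 1 n, coordFun (G n) n j a ∘ innov (backward (e n) n) =
        fun ω => bernoulliShift (e n) (G n) a ω j := fun a ha =>
      funext fun ω => coordFun_innov (Finset.mem_Icc.1 ha).2 j ω
    refine ⟨fun a ha => measurable_coordFun (hG_meas n a ha) j, fun a ha => ?_, fun a ha => ?_,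
      fun a ha k => ?_⟩
    · rw [hshift a ha]
      exact (hLp n a ha j).1
    · exact (congrArg (fun f => ∫ ω, f ω ∂(μ n)) (hshift a ha)).trans (hx_centered n a ha j)
    · have han := (Finset.mem_Icc.1 ha).2
      unfold influence
      simp only [coordFun_innov han, coordFun_resample han]
      by_cases hk : n - a ≤ k
      · have hlag : (a : ℤ) - n + k = ((k - (n - a) : ℕ) : ℤ) := by omega
        simp only [hk, if_true]
        rw [hlag, lagExt_natCast]
        refine le_trans ?_ (le_iSup _ (j : ℕ))
        unfold physDep
        exact le_iSup_of_le n (le_iSup₂_of_le a ha (le_iSup_of_le j.2 le_rfl))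
      -- an innovation later than the time `a` has no influence
      · simp [hk]
  have hdec := fun n (hn : 1 ≤ n) => exists_bias_add_fluctuation (he_meas n) (he_indep n)
    (hG_meas n) (hL n hn).1 (hL n hn).2 (hB_meas n) (hB_law n) (hB_indep n) (hB_data n) hp hϑ hϑ'
    (hrow n)
  have hC := errorConst_pos p ϑ
  set C := errorConst p ϑ
  refine ⟨fun δ hδ => ?_, fun δ hδ => ?_⟩
  · obtain ⟨M, hM, hMδ⟩ := exists_bound_rpow_le (q := 2) (C := 2 * C) (by norm_num) (by positivity) hδ
    refine ⟨M, by linarith, ?_⟩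
    filter_upwards [eventually_ge_atTop 1] with n hn
    obtain ⟨hL1, hLn⟩ := hL n hn
    have hL0 : (0 : ℝ) < L n := by exact_mod_cast hL1
    have hn0 : (0 : ℝ) < n := by exact_mod_cast hn
    have hratio : (L n : ℝ) / n ≤ √((L n : ℝ) / n) := by
      refine Real.le_sqrt_of_sq_le ?_
      have h1 : (L n : ℝ) / n ≤ 1 := (div_le_one hn0).2 (by exact_mod_cast hLn)
      have h0 : 0 ≤ (L n : ℝ) / n := by positivity
      nlinarith
    refine (measure_frobNorm_gt_le hC (s := √((L n : ℝ) / n) + 1 / L n) (by positivity)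
      (by linarith) fun j k => ?_).trans (ENNReal.ofReal_le_ofReal (by exact_mod_cast hMδ))
    obtain ⟨b, V, hVm, hV, hb, hVq⟩ := hdec n hn j k
    refine ⟨b, V, hVm, hV, hb.trans (by gcongr), ?_⟩
    calc eLpNorm V 2 (μ n) ≤ eLpNorm V (ENNReal.ofReal (p / 2)) (μ n) :=
          eLpNorm_le_eLpNorm_of_exponent_le (by
            rw [← ENNReal.ofReal_ofNat]; exact ENNReal.ofReal_le_ofReal (by linarith))
            hVm.aestronglyMeasurable
      _ ≤ _ := hVq.trans (ENNReal.ofReal_le_ofReal (by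
          gcongr; exact le_add_of_nonneg_right (by positivity)))
  · obtain ⟨M, hM, hMδ⟩ := exists_bound_rpow_le (q := p / 2) (C := C) (by linarith) hC hδ
    refine ⟨M, by linarith, ?_⟩
    filter_upwards [eventually_ge_atTop 1] with n hn
    obtain ⟨hL1, hLn⟩ := hL n hn
    have hL0 : (0 : ℝ) < L n := by exact_mod_cast hL1
    have hn0 : (0 : ℝ) < n := by exact_mod_cast hn
    -- the `d²` entries of the union bound are absorbed by `d ^ (4 / p)` at the power `p / 2`
    have hDq : ((d n : ℝ) ^ (4 / p)) ^ (p / 2) = (d n : ℝ) ^ 2 := by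
      rw [← Real.rpow_mul (Nat.cast_nonneg _), ← Real.rpow_natCast]
      congr 1
      field_simp
      norm_num
    have h := measure_maxNorm_gt_le (μ := μ n) (q := p / 2) (s := √((L n : ℝ) / n))
      (β := (L n : ℝ) / n + 1 / L n) (D := (d n : ℝ) ^ (4 / p)) (by linarith) hC (by positivity)
      (by positivity) (by positivity) hDq hM (hdec n hn)
    simp only [← add_assoc] at h
    exact h.trans (ENNReal.ofReal_le_ofReal hMδ)
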